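/- Let $0<d\le 1/2$ be constant and put $\theta=\ln(1/d)$. For a graph $H$ on the vertex set $[n]$ and an integer $0\le m\le|\overline E(H)|$, where $\overline E(H)$ is the set of non-edges of $H$ (unordered pairs of distinct non-adjacent vertices), let $H+R_m$ be the random graph obtained by adding to $H$ the edges of a uniformly random $m$-element subset $R_m$ of $\overline E(H)$. (a) For every $\varepsilon>0$ there is $n_0$ such that for all $n\ge n_0$, every graph $H$ on $[n]$ with minimum degree at least $dn$, and every integer $m$ with $(30\theta+13)n\le m\le|\overline E(H)|$, the graph $H+R_m$ is Hamiltonian with probability at least $1-\varepsilon$. (b) If $d\le 1/10$, then there are graphs $H_n$ on $[n]$ such that for every $n\ge 3$ the graph $H_n$ is a complete bipartite graph with two non-empty parts of different sizes and with minimum degree at least $dn$, and such that for every $\varepsilon>0$ there is $n_0$ such that for all $n\ge n_0$ and all integers $0\le m<\theta n/3$ one has $m\le|\overline E(H_n)|$ and the graph $H_n+R_m$ is not Hamiltonian with probability at least $1-\varepsilon$. -/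

import Mathlib

open Finset

/-- Graphs on the vertex set `Fin n` with minimum degree at least `d * n`. -/
def denseGraphs (n : ℕ) (d : ℝ) : Set (SimpleGraph (Fin n)) :=
  open Classical in {H | d * n ≤ (H.minDegree : ℝ)}

/-- The set of non-edges of `H`, that is, unordered pairs of distinct non-adjacent vertices. -/
noncomputable def nonEdges {n : ℕ} (H : SimpleGraph (Fin n)) : Finset (Sym2 (Fin n)) :=
  open Classical in Hᶜ.edgeFinset

/-- The graph `H + R`. -/
def addEdges {n : ℕ} (H : SimpleGraph (Fin n)) (R : Finset (Sym2 (Fin n))) :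
    SimpleGraph (Fin n) :=
  H ⊔ SimpleGraph.fromEdgeSet (R : Set (Sym2 (Fin n)))

/-- The probability that `H + R` satisfies `P`, where `R` is uniformly distributed over the
`m`-element sets of non-edges of `H` (the number of such sets is nonzero exactly when `m` is at
most the number of non-edges). -/
noncomputable def probAdd {n : ℕ} (H : SimpleGraph (Fin n)) (m : ℕ)
    (P : SimpleGraph (Fin n) → Prop) : ℝ :=
  open Classical in
  (#{R ∈ (nonEdges H).powersetCard m | P (addEdges H R)} : ℝ) /
    (#((nonEdges H).powersetCard m) : ℝ)

/-- `H` is a complete bipartite graph whose two parts have different sizes. -/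
def IsUnbalancedCompleteBipartite {n : ℕ} (H : SimpleGraph (Fin n)) : Prop :=
  ∃ A : Finset (Fin n), A.Nonempty ∧ #A < #Aᶜ ∧ ∀ u v, H.Adj u v ↔ (u ∈ A ↔ v ∉ A)

/-!
**Part (a).** If the random edges are exposed one at a time, with high probability all but the last
`8 * n` of them turn `H` into an expander: every set of at most `n / 4` vertices has twice as many
outside neighbours. For sets `S` with `3 * #S ≤ d * n` this follows from the minimum degree
condition on `H`. For larger `S` a failure means that no edge joins `S` to the complement of `S ∪ T`
for some `T` of size `2 * #S`; then `H` misses all these `#S * (n - 3 * #S)` pairs, so a random edge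
hits them with probability at least `#S / (2 * n)`, and a union bound over `(S, T)` applies
(`sum_obstructions_le`). The logarithm `log (1 / d)` is the entropy of sets of size about `d * n`.

In an expander, Pósa's rotations (`IsPathSeq.exists_endpoints`) show that a longest path covers
about `3 * n / 4` vertices, and that at least `n ^ 2 / 32` non-edges are boosters: adding one closes
a longest path to a cycle, which by connectivity is Hamiltonian or yields a longer path
(`Expands.exists_boosters`). Each further random edge is a booster with probability at least
`1 / 16`, and about `n / 4` boosters suffice. The exponential potential `2 ^ hamDeficit`, which
contracts in mean by the factor `31 / 32`, bounds the probability that `8 * n` edges do not provide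
them (`avgStep_pow_pos_le`).

Probabilities are computed with the averaging operator `avgStep` of one exposure step; its `m`-th
power evaluated at `∅` is the expectation over a uniformly random `m`-element set
(`avgStep_pow_mul_choose`).

**Part (b).** Let `H` be complete bipartite with parts `A` of size `⌈d * n⌉₊` and `Aᶜ`. A vertex of
`Aᶜ` without random edges inside `Aᶜ` has all its neighbours in `A`, so more than `#A` such vertices
exclude a Hamiltonian cycle. For `m < log (1 / d) * n / 3` their expected number is at least about
`9 / 10 * n * d ^ (4 / 5)`, which exceeds `d * n` by a constant factor, and Chebyshev's inequality
(`avgStep_pow_few_missed_le`) concentrates it.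
-/

/-! ### Paths as sequences, and rotations -/

/-- The first `k + 1` terms of the sequence `p` are the vertices of a path with `k` edges in `G`.
The later terms are irrelevant. -/
structure IsPathSeq {V : Type*} (G : SimpleGraph V) (p : ℕ → V) (k : ℕ) : Prop where
  inj : Set.InjOn p (Set.Iic k)
  adj : ∀ j < k, G.Adj (p j) (p (j + 1))

/-- The sequence obtained from `p` by reversing the segment `p (i + 1), …, p k`. If `p` is a path
and `p k` is adjacent to `p i`, this is Pósa's rotation of the path with pivot `p i`. -/
def rotateSeq {V : Type*} (p : ℕ → V) (k i : ℕ) : ℕ → V :=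
  fun j => if j ≤ i then p j else p (k + i + 1 - j)

/-- `RotReach G k p q`: the path `q` arises from the path `p` with `k` edges by rotations that keep
the first vertex fixed. -/
inductive RotReach {V : Type*} (G : SimpleGraph V) (k : ℕ) (p : ℕ → V) : (ℕ → V) → Prop
  | refl : RotReach G k p p
  | rotate (q : ℕ → V) (i : ℕ) (hi : i < k) (hq : RotReach G k p q) (h : G.Adj (q k) (q i)) :
      RotReach G k p (rotateSeq q k i)

/-- The vertices outside `S` that have a neighbour in `S`. -/
noncomputable def extNbhd {V : Type*} [Fintype V] (G : SimpleGraph V) (S : Finset V) : Finset V :=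
  open Classical in {u | u ∉ S ∧ ∃ x ∈ S, G.Adj x u}

section Paths

variable {V : Type*} {G : SimpleGraph V} {p q : ℕ → V} {k : ℕ}

lemma mem_extNbhd [Fintype V] {S : Finset V} {u : V} :
    u ∈ extNbhd G S ↔ u ∉ S ∧ ∃ x ∈ S, G.Adj x u := by
  simp [extNbhd]

lemma IsPathSeq.mono {G' : SimpleGraph V} (h : G ≤ G') (hp : IsPathSeq G p k) :
    IsPathSeq G' p k :=
  ⟨hp.inj, fun j hj => h (hp.adj j hj)⟩

lemma IsPathSeq.lt_card [Fintype V] (hp : IsPathSeq G p k) : k < Fintype.card V := by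
  classical
  have h1 : #((range (k + 1)).image p) = k + 1 := by
    rw [card_image_of_injOn, card_range]
    intro a ha b hb hab
    refine hp.inj ?_ ?_ hab
    · simpa [Nat.lt_succ_iff] using ha
    · simpa [Nat.lt_succ_iff] using hb
  have h2 := card_le_univ ((range (k + 1)).image p)
  omega

lemma IsPathSeq.reverse (hp : IsPathSeq G p k) : IsPathSeq G (fun j => p (k - j)) k := by
  refine ⟨fun a ha b hb hab => ?_, fun j hj => ?_⟩
  · simp only [Set.mem_Iic] at ha hb
    have := hp.inj (by simp : k - a ∈ Set.Iic k) (by simp : k - b ∈ Set.Iic k) hab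
    omega
  · have h := hp.adj (k - (j + 1)) (by omega)
    rw [show k - (j + 1) + 1 = k - j by omega] at h
    exact h.symm

lemma IsPathSeq.extend (hp : IsPathSeq G p k) {u : V} (hu : ∀ j ≤ k, p j ≠ u)
    (h : G.Adj (p k) u) : ∃ q, IsPathSeq G q (k + 1) := by
  refine ⟨fun j => if j ≤ k then p j else u, fun a ha b hb hab => ?_, fun j hj => ?_⟩
  · simp only [Set.mem_Iic] at ha hb
    by_cases h1 : a ≤ k <;> by_cases h2 : b ≤ k <;> simp only [h1, h2, if_true, if_false] at hab
    · exact hp.inj h1 h2 hab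
    · exact absurd hab (hu a h1)
    · exact absurd hab.symm (hu b h2)
    · omega
  · by_cases h1 : j + 1 ≤ k
    · simp only [h1, show j ≤ k by omega, if_true]
      exact hp.adj j (by omega)
    · obtain rfl : j = k := by omega
      simpa using h

lemma IsPathSeq.rotate (hp : IsPathSeq G p k) {i : ℕ} (h : G.Adj (p k) (p i)) :
    IsPathSeq G (rotateSeq p k i) k := by
  refine ⟨fun a ha b hb hab => ?_, fun j hj => ?_⟩
  · simp only [Set.mem_Iic] at ha hb
    unfold rotateSeq at hab
    split_ifs at hab with h1 h2 h2
    · exact hp.inj (by simpa using ha) (by simpa using hb) hab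
    · have := hp.inj (by simpa using ha) (by simp; omega) hab
      omega
    · have := hp.inj (by simp; omega) (by simpa using hb) hab
      omega
    · have := hp.inj (by simp; omega) (by simp; omega) hab
      omega
  · unfold rotateSeq
    split_ifs with h1 h2 h2
    · exact hp.adj j hj
    · rw [show k + i + 1 - (j + 1) = k by omega, show j = i by omega]
      exact h.symm
    · omega
    · have h' := hp.adj (k + i + 1 - (j + 1)) (by omega)
      rw [show k + i + 1 - (j + 1) + 1 = k + i + 1 - j by omega] at h'
      exact h'.symm

lemma RotReach.isPathSeq (hp : IsPathSeq G p k) (h : RotReach G k p q) : IsPathSeq G q k := by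
  induction h with
  | refl => exact hp
  | rotate _ _ _ _ h ih => exact ih.rotate h

lemma RotReach.zero_eq (h : RotReach G k p q) : q 0 = p 0 := by
  induction h with
  | refl => rfl
  | rotate _ _ _ _ _ ih => simpa [rotateSeq] using ih

lemma RotReach.exists_eq (h : RotReach G k p q) : ∀ j ≤ k, ∃ i ≤ k, q j = p i := by
  induction h with
  | refl => exact fun j hj => ⟨j, hj, rfl⟩
  | rotate q i _ _ _ ih =>
    intro j hj
    unfold rotateSeq
    split_ifs with h1
    · exact ih j hj
    · exact ih _ (by omega)

/-- `u` and `w` are consecutive, in either order, among the first `k + 1` terms of `p`. -/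
def SeqNbr (p : ℕ → V) (k : ℕ) (u w : V) : Prop :=
  ∃ j < k, (p j = u ∧ p (j + 1) = w) ∨ (p j = w ∧ p (j + 1) = u)

/-- If neither `u` nor a neighbour of `u` along `p` is the endpoint of a path obtained by rotations,
then no rotation has removed or added a path edge at `u`. -/
lemma RotReach.seqNbr (h : RotReach G k p q) {u : V}
    (hu : ∀ q', RotReach G k p q' → q' k ≠ u ∧ ¬ SeqNbr p k u (q' k)) :
    ∀ w, SeqNbr q k u w → SeqNbr p k u w := by
  induction h with
  | refl => exact fun w hw => hw
  | rotate q i hi hq h ih =>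
    -- The rotated path ends at `q (i + 1)`, so the pivot `q i` cannot be `u`.
    have hpiv : q i ≠ u := by
      intro hqi
      have h1 := hu _ (RotReach.rotate q i hi hq h)
      have h2 : rotateSeq q k i k = q (i + 1) := by
        unfold rotateSeq
        rw [if_neg (by omega)]
        congr 1
        omega
      rw [h2] at h1
      exact h1.2 (ih _ ⟨i, hi, Or.inl ⟨hqi, rfl⟩⟩)
    have hend := (hu q hq).1
    rintro w ⟨j, hj, hjw⟩
    apply ih
    unfold rotateSeq at hjw
    split_ifs at hjw with h1 h2 h2
    · exact ⟨j, hj, hjw⟩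
    · rw [show k + i + 1 - (j + 1) = k by omega, show j = i by omega] at hjw
      rcases hjw with hjw | hjw
      · exact absurd hjw.1 hpiv
      · exact absurd hjw.2 hend
    · omega
    · refine ⟨k + i + 1 - (j + 1), by omega, ?_⟩
      rw [show k + i + 1 - (j + 1) + 1 = k + i + 1 - j by omega]
      tauto

/-- **Pósa's lemma.** The set `B` of endpoints that rotations of a longest path produce has fewer
than `2 * #B` outside neighbours, and all of these lie on the path. -/
theorem IsPathSeq.exists_endpoints [Fintype V] (hp : IsPathSeq G p k)
    (hmax : ∀ q, ¬ IsPathSeq G q (k + 1)) :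
    ∃ B : Finset V, B.Nonempty ∧ (∀ y ∈ B, ∃ q, IsPathSeq G q k ∧ q 0 = p 0 ∧ q k = y) ∧
      #(extNbhd G B) < 2 * #B ∧ (∀ y ∈ B, ∃ j ≤ k, p j = y) ∧
      ∀ y ∈ extNbhd G B, ∃ j ≤ k, p j = y := by
  classical
  let B : Finset V := {y | ∃ q, RotReach G k p q ∧ q k = y}
  have hB : ∀ y, y ∈ B ↔ ∃ q, RotReach G k p q ∧ q k = y := fun y => by simp [B]
  have hBp : ∀ y ∈ B, ∃ j ≤ k, p j = y := by
    intro y hy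
    obtain ⟨q, hq, rfl⟩ := (hB y).1 hy
    obtain ⟨i, hi, h⟩ := hq.exists_eq k le_rfl
    exact ⟨i, hi, h.symm⟩
  have hpk : p k ∈ B := (hB _).2 ⟨p, .refl, rfl⟩
  have key : ∀ u ∈ extNbhd G B, ∃ y ∈ B, SeqNbr p k u y := by
    intro u hu
    obtain ⟨huB, x, hx, hxu⟩ := mem_extNbhd.1 hu
    obtain ⟨q, hq, rfl⟩ := (hB x).1 hx
    have hqp := hq.isPathSeq hp
    by_contra hcon
    push Not at hcon
    have hu' : ∀ q', RotReach G k p q' → q' k ≠ u ∧ ¬ SeqNbr p k u (q' k) := fun q' hq' =>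
      ⟨fun h => huB ((hB u).2 ⟨q', hq', h⟩), hcon _ ((hB _).2 ⟨q', hq', rfl⟩)⟩
    have huq : ∃ i ≤ k, q i = u := by
      by_contra hne
      push Not at hne
      obtain ⟨r, hr⟩ := hqp.extend hne hxu
      exact hmax r hr
    obtain ⟨i, hi, rfl⟩ := huq
    have hik : i < k := by
      rcases hi.lt_or_eq with h | h
      · exact h
      · exact absurd (h ▸ hxu) (G.irrefl)
    refine (hu' _ (RotReach.rotate q i hik hq hxu)).2 ?_
    refine hq.seqNbr hu' _ ⟨i, hik, Or.inl ⟨rfl, ?_⟩⟩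
    unfold rotateSeq
    rw [if_neg (by omega)]
    congr 1
    omega
  let J : Finset ℕ := {j ∈ range (k + 1) | p j ∈ B}
  have hkJ : k ∈ J := by simp [J, hpk]
  have hJ : #J ≤ #B := by
    refine card_le_card_of_injOn p (fun j hj => ?_) (fun a ha b hb hab => ?_)
    · exact (mem_filter.1 hj).2
    · simp only [J, coe_filter, mem_range, Set.mem_ofPred_eq] at ha hb
      exact hp.inj (Nat.lt_succ_iff.1 ha.1) (Nat.lt_succ_iff.1 hb.1) hab
  -- The last vertex of `p` is in `B` and has no successor; this makes the inequality strict.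
  have hsub : extNbhd G B ⊆
      (J.erase k).image (fun j => p (j + 1)) ∪ J.image (fun j => p (j - 1)) := by
    intro u hu
    obtain ⟨y, hy, j, hj, h | h⟩ := key u hu
    · refine mem_union_right _ (mem_image.2 ⟨j + 1, ?_, by simpa using h.1⟩)
      simp only [J, mem_filter, mem_range]
      exact ⟨by omega, h.2 ▸ hy⟩
    · refine mem_union_left _ (mem_image.2 ⟨j, ?_, h.2⟩)
      simp only [J, mem_erase, mem_filter, mem_range]
      exact ⟨by omega, by omega, h.1 ▸ hy⟩
  refine ⟨B, ⟨_, hpk⟩, ?_, ?_, hBp, ?_⟩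
  · intro y hy
    obtain ⟨q, hq, h⟩ := (hB y).1 hy
    exact ⟨q, hq.isPathSeq hp, hq.zero_eq, h⟩
  · have h1 := card_le_card hsub
    have h2 := card_union_le ((J.erase k).image (fun j => p (j + 1))) (J.image (fun j => p (j - 1)))
    have h3 := card_image_le (s := J.erase k) (f := fun j => p (j + 1))
    have h4 := card_image_le (s := J) (f := fun j => p (j - 1))
    rw [card_erase_of_mem hkJ] at h3
    have h5 : 0 < #J := card_pos.2 ⟨k, hkJ⟩
    omega
  · intro u hu
    obtain ⟨y, hy, j, hj, h | h⟩ := key u hu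
    · exact ⟨j, hj.le, h.1⟩
    · exact ⟨j + 1, hj, h.2⟩

/-! ### Hamiltonian cycles as sequences -/

lemma IsPathSeq.exists_walk (hp : IsPathSeq G p k) :
    ∃ w : G.Walk (p 0) (p k), w.length = k ∧ ∀ i ≤ k, w.getVert i = p i := by
  induction k with
  | zero => exact ⟨.nil, rfl, fun i hi => by simp [Nat.le_zero.1 hi]⟩
  | succ k ih =>
    obtain ⟨w, hw, hv⟩ := ih ⟨hp.inj.mono (Set.Iic_subset_Iic.2 (by omega)),
      fun j hj => hp.adj j (by omega)⟩
    refine ⟨w.concat (hp.adj k (by omega)), by simp [hw], fun i hi => ?_⟩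
    rw [SimpleGraph.Walk.concat_eq_append, SimpleGraph.Walk.getVert_append, hw]
    split_ifs with h
    · exact hv i h.le
    · obtain rfl | rfl : i = k ∨ i = k + 1 := by omega
      · simp
      · simp

/-- A path through all vertices whose ends are adjacent closes to a Hamiltonian cycle. -/
lemma IsPathSeq.isHamiltonian [Fintype V] [DecidableEq V] (hp : IsPathSeq G p k)
    (hk : k + 1 = Fintype.card V) (hk2 : 2 ≤ k) (h : G.Adj (p k) (p 0)) : G.IsHamiltonian := by
  obtain ⟨w, hw, hv⟩ := hp.exists_walk
  have hpath : w.IsPath := by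
    rw [← SimpleGraph.Walk.IsPath.getVert_injOn_iff, hw]
    intro a ha b hb hab
    rw [hv a ha, hv b hb] at hab
    exact hp.inj ha hb hab
  refine fun _ => ⟨p k, w.cons h, ?_⟩
  rw [SimpleGraph.Walk.isHamiltonianCycle_iff_isCycle_and_length_eq]
  refine ⟨(SimpleGraph.Walk.cons_isCycle_iff _ _).2 ⟨hpath, fun hmem => ?_⟩, by simp [hw, hk]⟩
  obtain ⟨i, hi, hs⟩ := (SimpleGraph.Walk.mk_mem_edges_iff_exists _).1 hmem
  rw [hw] at hi
  rw [hv i hi.le, hv (i + 1) hi, Sym2.eq_iff] at hs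
  have e0 : (0 : ℕ) ∈ Set.Iic k := by simp
  have ei : i ∈ Set.Iic k := hi.le
  have ei' : i + 1 ∈ Set.Iic k := hi
  have ek : k ∈ Set.Iic k := by simp
  rcases hs with hs | hs
  · have := hp.inj ei ek hs.1
    omega
  · have := hp.inj ei e0 hs.1
    have := hp.inj ei' ek hs.2
    omega

/-- In a Hamiltonian graph a set `I` is at most as large as any set `A` that contains all neighbours
of its vertices, since each vertex of `I` is followed on the cycle by a vertex of `A`. -/
lemma SimpleGraph.IsHamiltonian.card_le_of_forall_adj [Fintype V] [DecidableEq V]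
    (hG : G.IsHamiltonian) (hV : Fintype.card V ≠ 1) {I A : Finset V}
    (hIA : ∀ u ∈ I, ∀ v, G.Adj u v → v ∈ A) : #I ≤ #A := by
  obtain ⟨a, w, hw⟩ := hG hV
  have hlen : ∀ v, ∃ i < w.length, w.getVert i = v := by
    intro v
    obtain ⟨i, hi, hil⟩ := SimpleGraph.Walk.mem_support_iff_exists_getVert.1 (hw.mem_support v)
    rcases hil.lt_or_eq with h | h
    · exact ⟨i, h, hi⟩
    · have h3 := hw.isCycle.three_le_length
      refine ⟨0, by omega, ?_⟩
      rw [← hi, h]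
      simp
  choose f hf hfv using hlen
  refine card_le_card_of_injOn (fun v => w.getVert (f v + 1)) (fun v hv => ?_)
    (fun u _ v _ huv => ?_)
  · refine hIA v hv _ ?_
    have := w.adj_getVert_succ (hf v)
    rwa [hfv] at this
  · have := hw.isCycle.getVert_injOn (by simpa using hf u) (by simpa using hf v) huv
    rw [← hfv u, ← hfv v, Nat.succ_injective this]

end Paths

/-! ### Expansion, and the edges that improve a longest path -/

/-- Every non-empty set of at most a quarter of the vertices has at least twice as many outside
neighbours. -/
def Expands {V : Type*} [Fintype V] (G : SimpleGraph V) : Prop :=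
  ∀ S : Finset V, S.Nonempty → 4 * #S ≤ Fintype.card V → 2 * #S ≤ #(extNbhd G S)

/-- The number of edges of a longest path of `G`. -/
noncomputable def longestPath {V : Type*} [Fintype V] (G : SimpleGraph V) : ℕ :=
  open Classical in Nat.findGreatest (fun k => ∃ p, IsPathSeq G p k) (Fintype.card V)

/-- Zero for a Hamiltonian graph, and otherwise the number of vertices minus the number of edges of
a longest path, which is positive. -/
noncomputable def hamDeficit {V : Type*} [Fintype V] [DecidableEq V] (G : SimpleGraph V) : ℕ :=
  open Classical in if G.IsHamiltonian then 0 else Fintype.card V - longestPath G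

section Expansion

variable {V : Type*} [Fintype V] {G G' : SimpleGraph V} {k : ℕ}

lemma extNbhd_mono (h : G ≤ G') (S : Finset V) : extNbhd G S ⊆ extNbhd G' S := by
  intro u hu
  obtain ⟨h1, x, hx, hxu⟩ := mem_extNbhd.1 hu
  exact mem_extNbhd.2 ⟨h1, x, hx, h hxu⟩

lemma Expands.mono (hG : Expands G) (h : G ≤ G') : Expands G' := fun S hS hS4 =>
  (hG S hS hS4).trans (card_le_card (extNbhd_mono h S))

/-- In an expanding graph, a set with at least a quarter of the vertices and its neighbours make up
almost three quarters of the vertices. -/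
lemma Expands.le_card (hG : Expands G) {S W : Finset V} (hS : Fintype.card V / 4 ≤ #S)
    (hSW : S ⊆ W) (hW : extNbhd G S ⊆ W) : 3 * (Fintype.card V / 4) ≤ #W := by
  classical
  obtain ⟨T, hTS, hT⟩ := exists_subset_card_eq hS
  rcases Nat.eq_zero_or_pos (Fintype.card V / 4) with h0 | h0
  · omega
  have h1 := hG T (card_pos.1 (hT ▸ h0)) (by omega)
  have h2 : T ∪ extNbhd G T ⊆ W := by
    refine union_subset (hTS.trans hSW) fun u hu => ?_
    obtain ⟨_, x, hx, hxu⟩ := mem_extNbhd.1 hu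
    by_cases huS : u ∈ S
    · exact hSW huS
    · exact hW (mem_extNbhd.2 ⟨huS, x, hTS hx, hxu⟩)
  have h3 := card_le_card h2
  rw [card_union_of_disjoint] at h3
  · omega
  · exact disjoint_left.2 fun u hu hu' => (mem_extNbhd.1 hu').1 hu

/-- An expanding graph is connected: no proper non-empty set of vertices is closed under
adjacency, as both it and its complement would contain almost three quarters of the vertices. -/
lemma Expands.extNbhd_nonempty (hG : Expands G) (hV : 8 ≤ Fintype.card V) {S : Finset V}
    (hS : S.Nonempty) (hS' : S ≠ univ) : (extNbhd G S).Nonempty := by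
  classical
  have key : ∀ W : Finset V, W.Nonempty → extNbhd G W = ∅ → 3 * (Fintype.card V / 4) ≤ #W := by
    intro W hW he
    by_cases h4 : 4 * #W ≤ Fintype.card V
    · have h1 := hG W hW h4
      have h2 := card_pos.2 hW
      simp only [he, card_empty] at h1
      omega
    · exact hG.le_card (by omega) subset_rfl (by simp [he])
  rw [nonempty_iff_ne_empty]
  intro he
  have h1 := key S hS he
  have h2 := key Sᶜ (by rwa [nonempty_iff_ne_empty, Ne, compl_eq_empty_iff]) (by
    rw [eq_empty_iff_forall_notMem]
    intro u hu
    obtain ⟨huS, x, hx, hxu⟩ := mem_extNbhd.1 hu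
    rw [mem_compl, not_not] at huS
    have : x ∈ extNbhd G S := mem_extNbhd.2 ⟨by simpa using hx, u, huS, hxu.symm⟩
    simp [he] at this)
  have h3 := card_add_card_compl S
  omega

/-- In an expanding graph, a path whose ends are adjacent either is spanning, so that the graph is
Hamiltonian, or can be opened elsewhere and extended. -/
lemma Expands.isHamiltonian_or_exists [DecidableEq V] (hG : Expands G) (hV : 8 ≤ Fintype.card V)
    {q : ℕ → V} (hq : IsPathSeq G q k) (hk : 2 ≤ k) (h : G.Adj (q k) (q 0)) :
    G.IsHamiltonian ∨ ∃ r, IsPathSeq G r (k + 1) := by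
  by_cases hkV : k + 1 = Fintype.card V
  · exact Or.inl (hq.isHamiltonian hkV hk h)
  right
  have hlt := hq.lt_card
  have hne : (range (k + 1)).image q ≠ univ := by
    intro he
    have h1 := card_image_le (s := range (k + 1)) (f := q)
    rw [he, card_univ, card_range] at h1
    omega
  obtain ⟨u, hu⟩ := hG.extNbhd_nonempty hV (by simp) hne
  obtain ⟨huq, x, hx, hxu⟩ := mem_extNbhd.1 hu
  obtain ⟨i, hi, rfl⟩ := mem_image.1 hx
  rw [mem_range] at hi
  have huq' : ∀ j ≤ k, q j ≠ u := fun j hj hju =>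
    huq (mem_image.2 ⟨j, by simpa [Nat.lt_succ_iff] using hj, hju⟩)
  have hc : IsPathSeq G (fun j => if i + 1 + j ≤ k then q (i + 1 + j) else q (i + j - k)) k := by
    refine ⟨fun a ha b hb hab => ?_, fun j hj => ?_⟩
    · simp only [Set.mem_Iic] at ha hb
      split_ifs at hab with h1 h2 h2
      all_goals
        have := hq.inj (by simp; omega) (by simp; omega) hab
        omega
    · split_ifs with h1 h2 h2
      · exact hq.adj _ (by omega)
      · rw [show i + 1 + j = k by omega, show i + (j + 1) - k = 0 by omega]
        exact h
      · omega
      · rw [show i + (j + 1) - k = i + j - k + 1 by omega]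
        exact hq.adj _ (by omega)
  refine hc.extend (u := u) (fun j hj => ?_) ?_
  · split_ifs with h1
    · exact huq' _ h1
    · exact huq' _ (by omega)
  · rw [if_neg (by omega), show i + k - k = i by omega]
    exact hxu

lemma exists_isPathSeq_longestPath [Nonempty V] (G : SimpleGraph V) :
    ∃ p, IsPathSeq G p (longestPath G) := by
  classical
  obtain ⟨v⟩ := ‹Nonempty V›
  unfold longestPath
  refine Nat.findGreatest_spec (P := fun k => ∃ p, IsPathSeq G p k) (m := 0) (by omega)
    ⟨fun _ => v, fun a ha b hb _ => ?_, fun j hj => by omega⟩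
  simp only [Set.mem_Iic] at ha hb
  omega

lemma IsPathSeq.le_longestPath {p : ℕ → V} (hp : IsPathSeq G p k) : k ≤ longestPath G := by
  classical
  exact Nat.le_findGreatest (P := fun k => ∃ p, IsPathSeq G p k) hp.lt_card.le ⟨p, hp⟩

lemma longestPath_lt [Nonempty V] (G : SimpleGraph V) : longestPath G < Fintype.card V := by
  obtain ⟨p, hp⟩ := exists_isPathSeq_longestPath G
  exact hp.lt_card

variable [DecidableEq V]

lemma hamDeficit_eq_zero [Nonempty V] : hamDeficit G = 0 ↔ G.IsHamiltonian := by
  have := longestPath_lt G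
  unfold hamDeficit
  split_ifs with h
  · simp [h]
  · simp only [h, iff_false]
    omega

lemma hamDeficit_anti [Nonempty V] (h : G ≤ G') : hamDeficit G' ≤ hamDeficit G := by
  obtain ⟨p, hp⟩ := exists_isPathSeq_longestPath G
  have h1 := (hp.mono h).le_longestPath
  unfold hamDeficit
  split_ifs with h2 h3
  · exact le_rfl
  · exact Nat.zero_le _
  · exact absurd (SimpleGraph.IsHamiltonian.mono h ‹_›) h2
  · omega

lemma Expands.longestPath_ge [Nonempty V] (hG : Expands G) :
    3 * (Fintype.card V / 4) ≤ longestPath G + 1 := by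
  obtain ⟨p, hp⟩ := exists_isPathSeq_longestPath G
  obtain ⟨B, hBne, -, hBN, hB1, hB2⟩ := hp.exists_endpoints
    (fun q hq => by have := hq.le_longestPath; omega)
  have hB4 : Fintype.card V / 4 ≤ #B := by
    by_contra hlt
    have := hG B hBne (by omega)
    omega
  have h1 := hG.le_card (W := (range (longestPath G + 1)).image p) hB4
    (fun y hy => by
      obtain ⟨j, hj, rfl⟩ := hB1 y hy
      exact mem_image_of_mem _ (by simpa [Nat.lt_succ_iff] using hj))
    (fun y hy => by
      obtain ⟨j, hj, rfl⟩ := hB2 y hy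
      exact mem_image_of_mem _ (by simpa [Nat.lt_succ_iff] using hj))
  refine h1.trans (card_image_le.trans ?_)
  simp

lemma Expands.hamDeficit_le [Nonempty V] (hG : Expands G) :
    4 * hamDeficit G ≤ Fintype.card V + 13 := by
  have := hG.longestPath_ge
  unfold hamDeficit
  split_ifs <;> omega

/-- An expanding non-Hamiltonian graph has quadratically many non-edges whose addition makes it
Hamiltonian or makes its longest path longer: the pairs `{x, y}` of ends of longest paths. -/
theorem Expands.exists_boosters [Nonempty V] (hG : Expands G) (hV : 8 ≤ Fintype.card V)
    (hH : ¬ G.IsHamiltonian) :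
    ∃ 𝓑 : Finset (Sym2 V), Fintype.card V ^ 2 ≤ 32 * #𝓑 ∧
      ∀ e ∈ 𝓑, e ∈ Gᶜ.edgeSet ∧
        ∀ G', G ≤ G' → e ∈ G'.edgeSet → hamDeficit G' < hamDeficit G := by
  set k := longestPath G with hk
  have hmax : ∀ q, ¬ IsPathSeq G q (k + 1) := fun q hq => by
    have := hq.le_longestPath
    omega
  have hk2 : 2 ≤ k := by
    have := hG.longestPath_ge
    omega
  have hend : ∀ p, IsPathSeq G p k → ∃ B : Finset V, Fintype.card V ≤ 4 * #B ∧
      ∀ y ∈ B, ∃ q, IsPathSeq G q k ∧ q 0 = p 0 ∧ q k = y := by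
    intro p hp
    obtain ⟨B, hBne, hB, hBN, -, -⟩ := hp.exists_endpoints hmax
    refine ⟨B, ?_, hB⟩
    by_contra hlt
    have := hG B hBne (by omega)
    omega
  obtain ⟨p, hp⟩ := exists_isPathSeq_longestPath G
  obtain ⟨B, hB4, hB⟩ := hend p hp
  have hB' : ∀ x : V, ∃ C : Finset V, x ∈ B → Fintype.card V ≤ 4 * #C ∧
      ∀ y ∈ C, ∃ q, IsPathSeq G q k ∧ q 0 = x ∧ q k = y := by
    intro x
    by_cases hx : x ∈ B
    · obtain ⟨q, hq, -, hqk⟩ := hB x hx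
      obtain ⟨C, hC, hC'⟩ := hend _ hq.reverse
      refine ⟨C, fun _ => ⟨hC, fun y hy => ?_⟩⟩
      obtain ⟨r, hr, hr0, hrk⟩ := hC' y hy
      exact ⟨r, hr, by simpa [hqk] using hr0, hrk⟩
    · exact ⟨∅, fun h => absurd h hx⟩
  choose C hC using hB'
  refine ⟨(B.sigma C).image fun e => s(e.1, e.2), ?_, ?_⟩
  · have h1 : #(B.sigma C) ≤ 2 * #((B.sigma C).image fun e => s(e.1, e.2)) := by
      refine card_le_mul_card_image _ 2 fun b _ => ?_
      induction b with
      | h x y =>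
        refine (card_le_card (t := {⟨x, y⟩, ⟨y, x⟩}) ?_).trans card_le_two
        rintro ⟨a, b⟩ hab
        have := (mem_filter.1 hab).2
        simp only [Sym2.eq_iff] at this
        rcases this with ⟨rfl, rfl⟩ | ⟨rfl, rfl⟩ <;> simp
    have h2 : #B * Fintype.card V ≤ 4 * #(B.sigma C) := by
      rw [card_sigma, mul_sum, ← smul_eq_mul, ← sum_const]
      exact sum_le_sum fun x hx => (hC x hx).1
    nlinarith [Nat.mul_le_mul_right (Fintype.card V) hB4]
  · intro e he
    obtain ⟨⟨x, y⟩, hxy, rfl⟩ := mem_image.1 he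
    rw [mem_sigma] at hxy
    obtain ⟨q, hq, hq0, hqk⟩ := (hC x hxy.1).2 y hxy.2
    dsimp only at hq0 hqk hxy
    subst hq0 hqk
    refine ⟨?_, fun G' hGG' he' => ?_⟩
    · rw [SimpleGraph.mem_edgeSet, SimpleGraph.compl_adj]
      refine ⟨fun h0 => ?_, fun h0 => ?_⟩
      · have := hq.inj (by simp : (0 : ℕ) ∈ Set.Iic k) (by simp : k ∈ Set.Iic k) h0
        omega
      · rcases hG.isHamiltonian_or_exists hV hq hk2 h0.symm with h1 | ⟨r, hr⟩
        · exact hH h1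
        · exact hmax r hr
    · have hlt := longestPath_lt G
      have he'' : G'.Adj (q k) (q 0) := SimpleGraph.Adj.symm he'
      have hd : hamDeficit G = Fintype.card V - k := by simp [hamDeficit, hH, hk]
      rcases (hG.mono hGG').isHamiltonian_or_exists hV (hq.mono hGG') hk2 he'' with h1 | ⟨r, hr⟩
      · rw [hamDeficit_eq_zero.2 h1]
        omega
      · have := hr.le_longestPath
        rw [hd, hamDeficit]
        split_ifs <;> omega

end Expansion

/-! ### Random subsets exposed one element at a time -/

/-- The averaging operator of one step of exposure: `avgStep E f R` is the mean of `f (R ∪ {e})`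
over a uniformly random `e ∈ E \ R` (and `0` if `E ⊆ R`). -/
noncomputable def avgStep {α : Type*} [DecidableEq α] (E : Finset α) :
    (Finset α → ℝ) →ₗ[ℝ] (Finset α → ℝ) where
  toFun f R := (∑ e ∈ E \ R, f (insert e R)) / #(E \ R)
  map_add' f g := by
    ext R
    simp [sum_add_distrib, add_div]
  map_smul' c f := by
    ext R
    simp [← mul_sum, mul_div_assoc]

/-- The indicator of the event that the random set misses `F`. -/
noncomputable def missInd {α : Type*} (F R : Finset α) : ℝ :=
  open Classical in if Disjoint F R then 1 else 0

section Exposure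

variable {α : Type*} [DecidableEq α] {E : Finset α}

lemma avgStep_apply (f : Finset α → ℝ) (R : Finset α) :
    avgStep E f R = (∑ e ∈ E \ R, f (insert e R)) / #(E \ R) := rfl

lemma insert_subset_of_mem_sdiff {R : Finset α} (hR : R ⊆ E) {e : α} (he : e ∈ E \ R) :
    insert e R ⊆ E :=
  insert_subset (mem_sdiff.1 he).1 hR

lemma avgStep_pow_mono {f g : Finset α → ℝ} (h : ∀ R ⊆ E, f R ≤ g R) (j : ℕ) :
    ∀ R ⊆ E, (avgStep E ^ j) f R ≤ (avgStep E ^ j) g R := by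
  induction j with
  | zero => exact h
  | succ j ih =>
    intro R hR
    rw [pow_succ', Module.End.mul_apply, Module.End.mul_apply, avgStep_apply, avgStep_apply]
    gcongr with e he
    exact ih _ (insert_subset_of_mem_sdiff hR he)

/-- If `f` contracts by the factor `c` in mean in one step from every set with the property `P`,
and `P` is inherited by larger sets, then `f` contracts by `c ^ j` in mean in `j` steps. -/
lemma avgStep_pow_le {f : Finset α → ℝ} {c : ℝ} (hc : 0 ≤ c) (P : Finset α → Prop)
    (hP : ∀ R R', R ⊆ R' → P R → P R')
    (h : ∀ R ⊆ E, P R → avgStep E f R ≤ c * f R) (j : ℕ) :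
    ∀ R ⊆ E, P R → (avgStep E ^ j) f R ≤ c ^ j * f R := by
  induction j with
  | zero => simp
  | succ j ih =>
    intro R hR hPR
    rw [pow_succ', Module.End.mul_apply, avgStep_apply]
    have h1 : (∑ e ∈ E \ R, (avgStep E ^ j) f (insert e R)) / #(E \ R) ≤
        (∑ e ∈ E \ R, c ^ j * f (insert e R)) / #(E \ R) := by
      gcongr with e he
      exact ih _ (insert_subset_of_mem_sdiff hR he) (hP _ _ (subset_insert e R) hPR)
    refine h1.trans ?_
    rw [← mul_sum, mul_div_assoc, ← avgStep_apply, pow_succ, mul_assoc]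
    gcongr
    exact h R hR hPR

lemma avgStep_pow_const_le {c : ℝ} (hc : 0 ≤ c) (j : ℕ) {R : Finset α} (hR : R ⊆ E) :
    (avgStep E ^ j) (fun _ => c) R ≤ c := by
  have := avgStep_pow_le (E := E) (f := fun _ => c) (c := 1) zero_le_one (fun _ => True)
    (fun _ _ _ _ => trivial) (fun R _ _ => ?_) j R hR trivial
  · simpa using this
  · rw [avgStep_apply, sum_const, nsmul_eq_mul, one_mul]
    rcases eq_or_ne (#(E \ R) : ℝ) 0 with h | h
    · simpa [h] using hc
    · field_simp
      exact le_rfl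

/-- Double counting of the pairs of a `(j + 1)`-element set and one of its elements. -/
lemma sum_sum_powersetCard_erase (X : Finset α) (j : ℕ) (g : Finset α → ℝ) :
    ∑ e ∈ X, ∑ S ∈ (X.erase e).powersetCard j, g (insert e S) =
      (j + 1) * ∑ S ∈ X.powersetCard (j + 1), g S := by
  have h1 : ∀ S ∈ X.powersetCard (j + 1), (j + 1 : ℝ) * g S = ∑ _e ∈ S, g S := by
    intro S hS
    rw [sum_const, (mem_powersetCard.1 hS).2, nsmul_eq_mul]
    push_cast
    ring
  rw [mul_sum, sum_congr rfl h1, sum_sigma', sum_sigma']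
  refine sum_bij' (fun a _ => ⟨insert a.1 a.2, a.1⟩) (fun b _ => ⟨b.2, b.1.erase b.2⟩)
    ?_ ?_ ?_ ?_ ?_
  · rintro ⟨e, S⟩ h
    simp only [mem_sigma, mem_powersetCard, subset_erase] at h ⊢
    refine ⟨⟨insert_subset h.1 h.2.1.1, ?_⟩, mem_insert_self _ _⟩
    rw [card_insert_of_notMem h.2.1.2, h.2.2]
  · rintro ⟨S, e⟩ h
    simp only [mem_sigma, mem_powersetCard] at h ⊢
    refine ⟨h.1.1 h.2, erase_subset_erase _ h.1.1, ?_⟩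
    rw [card_erase_of_mem h.2, h.1.2, Nat.add_sub_cancel]
  · rintro ⟨e, S⟩ h
    simp only [mem_sigma, mem_powersetCard, subset_erase] at h
    simp [erase_insert h.2.1.2]
  · rintro ⟨S, e⟩ h
    simp only [mem_sigma] at h
    simp [insert_erase h.2]
  · rintro ⟨e, S⟩ h
    rfl

/-- Exposing `j` elements one at a time yields a uniformly random `j`-element set. -/
theorem avgStep_pow_mul_choose (f : Finset α → ℝ) (j : ℕ) (R : Finset α) :
    (avgStep E ^ j) f R * (#(E \ R)).choose j = ∑ S ∈ (E \ R).powersetCard j, f (R ∪ S) := by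
  induction j generalizing R with
  | zero => simp
  | succ j ih =>
    rcases Nat.eq_zero_or_pos #(E \ R) with h0 | h0
    · have : E \ R = ∅ := card_eq_zero.1 h0
      rw [this, powersetCard_eq_empty.2 (by simp)]
      simp
    have hch : ((#(E \ R)).choose (j + 1) : ℝ) * (j + 1) =
        #(E \ R) * ((#(E \ R) - 1).choose j : ℕ) := by
      have := Nat.add_one_mul_choose_eq (#(E \ R) - 1) j
      rw [Nat.sub_add_cancel h0] at this
      exact_mod_cast this.symm
    have h1 : (∑ e ∈ E \ R, (avgStep E ^ j) f (insert e R)) * ((#(E \ R) - 1).choose j : ℕ) =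
        (j + 1) * ∑ S ∈ (E \ R).powersetCard (j + 1), f (R ∪ S) := by
      rw [← sum_sum_powersetCard_erase, sum_mul]
      refine sum_congr rfl fun e he => ?_
      have := ih (insert e R)
      rw [sdiff_insert, card_erase_of_mem he] at this
      rw [this]
      refine sum_congr rfl fun S _ => ?_
      rw [insert_union, union_insert]
    have hj : (j + 1 : ℝ) ≠ 0 := by positivity
    have hX : (#(E \ R) : ℝ) ≠ 0 := by positivity
    rw [pow_succ', Module.End.mul_apply, avgStep_apply, ← mul_right_inj' hj, ← h1,
      div_mul_eq_mul_div, ← mul_div_assoc, div_eq_iff hX]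
    linear_combination (∑ e ∈ E \ R, (avgStep E ^ j) f (insert e R)) * hch

/-- A random `j`-element subset of `E` misses a set `F ⊆ E` with probability at most
`(1 - #F / #E) ^ j`. -/
lemma avgStep_pow_missInd_le {F : Finset α} (hF : F ⊆ E) (j : ℕ) :
    (avgStep E ^ j) (missInd F) ∅ ≤ (1 - #F / #E : ℝ) ^ j := by
  have hle : (#F : ℝ) ≤ #E := by exact_mod_cast card_le_card hF
  have hc : (0 : ℝ) ≤ 1 - #F / #E := sub_nonneg.2 (div_le_one_of_le₀ hle (by positivity))
  have := avgStep_pow_le (E := E) (f := missInd F) hc (fun _ => True) (fun _ _ _ _ => trivial)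
    (fun R hR _ => ?_) j ∅ (empty_subset _) trivial
  · simpa [missInd] using this
  rw [avgStep_apply]
  by_cases hd : Disjoint F R
  · have hFX : F ⊆ E \ R := fun x hx => mem_sdiff.2 ⟨hF hx, disjoint_left.1 hd hx⟩
    have hX : ∑ e ∈ E \ R, missInd F (insert e R) = #(E \ R) - #F := by
      have h1 : ∀ e, missInd F (insert e R) = if e ∉ F then 1 else 0 := by
        intro e
        simp [missInd, disjoint_insert_right, hd]
      rw [sum_congr rfl fun e _ => h1 e, ← sum_filter, sum_const, nsmul_eq_mul, mul_one]
      have : ({e ∈ E \ R | e ∉ F} : Finset α) = (E \ R) \ F := by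
        ext e
        simp
      rw [this, card_sdiff_of_subset hFX, Nat.cast_sub (card_le_card hFX)]
    rw [hX]
    simp only [missInd, hd, if_true, mul_one]
    rcases eq_or_ne (#(E \ R) : ℝ) 0 with h | h
    · simpa [h] using hc
    · have hpos : (0 : ℝ) < #(E \ R) := by positivity
      rw [sub_div, div_self h]
      have : (#(E \ R) : ℝ) ≤ #E := by exact_mod_cast card_le_card sdiff_subset
      gcongr
  · have : ∀ e ∈ E \ R, missInd F (insert e R) = 0 := by
      intro e _
      simp [missInd, disjoint_insert_right, hd]
    rw [sum_congr rfl this]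
    simp [missInd, hd]

/-- Two-round exposure: if from every set that meets all of the sets `F i` the event `f` has
probability at most `δ` after `b` more steps, then it has probability at most `δ` plus the
union bound for missing some `F i` in the first `a` steps. -/
lemma avgStep_pow_add_le {ι : Type*} (I : Finset ι) (F : ι → Finset α) (hF : ∀ i ∈ I, F i ⊆ E)
    {f : Finset α → ℝ} (hf : ∀ R, f R ≤ 1) {δ : ℝ} (hδ : 0 ≤ δ) (a b : ℕ)
    (h : ∀ R ⊆ E, (∀ i ∈ I, ¬ Disjoint (F i) R) → (avgStep E ^ b) f R ≤ δ) :
    (avgStep E ^ (a + b)) f ∅ ≤ ∑ i ∈ I, (1 - #(F i) / #E : ℝ) ^ a + δ := by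
  have h1 : ∀ R ⊆ E, (avgStep E ^ b) f R ≤
      ((∑ i ∈ I, missInd (F i)) + fun _ => δ : Finset α → ℝ) R := by
    intro R hR
    rw [Pi.add_apply, Finset.sum_apply]
    have hnn : ∀ i ∈ I, 0 ≤ missInd (F i) R := fun i _ => by
      unfold missInd
      split_ifs <;> norm_num
    by_cases hd : ∀ i ∈ I, ¬ Disjoint (F i) R
    · linarith [h R hR hd, sum_nonneg hnn]
    · push Not at hd
      obtain ⟨i, hi, hd⟩ := hd
      have h2 := single_le_sum hnn hi
      have h3 : missInd (F i) R = 1 := by simp [missInd, hd]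
      have h4 := (avgStep_pow_mono (fun R _ => hf R) b R hR).trans
        (avgStep_pow_const_le zero_le_one b hR)
      linarith
  rw [pow_add, Module.End.mul_apply]
  refine (avgStep_pow_mono h1 a ∅ (empty_subset _)).trans ?_
  rw [map_add, map_sum, Pi.add_apply, Finset.sum_apply]
  gcongr with i hi
  · exact avgStep_pow_missInd_le (hF i hi) a
  · exact avgStep_pow_const_le hδ a (empty_subset _)

/-- If from every set with the inherited property `P` at least the proportion `2 * c` of the
possible steps decreases the potential `φ`, unless it is zero already, then `φ` is unlikely to be
positive after `j` steps. -/
lemma avgStep_pow_pos_le (φ : Finset α → ℕ) (hφ : ∀ R R', R ⊆ R' → φ R' ≤ φ R) {c : ℝ}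
    (hc : c ≤ 1) (P : Finset α → Prop) (hP : ∀ R R', R ⊆ R' → P R → P R')
    (h : ∀ R ⊆ E, P R → φ R ≠ 0 →
      2 * c * #(E \ R) ≤ #{e ∈ E \ R | φ (insert e R) < φ R}) (j : ℕ) {R : Finset α} (hR : R ⊆ E)
    (hPR : P R) :
    (avgStep E ^ j) (fun R => if φ R = 0 then 0 else 1) R ≤ (1 - c) ^ j * 2 ^ φ R := by
  -- The exponential potential `2 ^ φ`, cut off at `φ = 0`, contracts by `1 - c` in mean.
  let f : Finset α → ℝ := fun R => if φ R = 0 then 0 else 2 ^ φ R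
  have hfle : ∀ R, f R ≤ 2 ^ φ R := fun R => by
    simp only [f]
    split_ifs
    · positivity
    · exact le_rfl
  have h1 : ∀ R ⊆ E, (fun R => if φ R = 0 then (0 : ℝ) else 1) R ≤ f R := by
    intro R _
    simp only [f]
    split_ifs
    · exact le_rfl
    · exact one_le_pow₀ (by norm_num)
  have hc' : 0 ≤ 1 - c := by linarith
  refine (avgStep_pow_mono h1 j R hR).trans ((avgStep_pow_le hc' P hP ?_ j R hR hPR).trans ?_)
  · intro R hR hPR
    rw [avgStep_apply]
    by_cases h0 : φ R = 0
    · have : ∀ e ∈ E \ R, f (insert e R) = 0 := fun e _ => by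
        have := hφ R _ (subset_insert e R)
        simp only [f]
        rw [if_pos (by omega)]
      rw [sum_congr rfl this]
      simp [f, h0]
    · have hfR : f R = 2 ^ φ R := by simp [f, h0]
      have h2 : ∀ e ∈ E \ R, f (insert e R) ≤
          2 ^ φ R - if φ (insert e R) < φ R then (2 ^ φ R / 2 : ℝ) else 0 := by
        intro e _
        have h3 := hφ R _ (subset_insert e R)
        refine (hfle _).trans ?_
        split_ifs with h4
        · have : (2 : ℝ) ^ φ (insert e R) * 2 ≤ 2 ^ φ R := by
            rw [← pow_succ]
            exact pow_le_pow_right₀ (by norm_num) h4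
          linarith
        · rw [show φ (insert e R) = φ R by omega, sub_zero]
      rcases Nat.eq_zero_or_pos #(E \ R) with hX | hX
      · rw [hX, Nat.cast_zero, div_zero]
        rw [hfR]
        positivity
      · rw [div_le_iff₀ (by positivity)]
        refine (sum_le_sum h2).trans ?_
        rw [sum_sub_distrib, sum_const, nsmul_eq_mul, ← sum_filter, sum_const, nsmul_eq_mul, hfR]
        have h5 := h R hR hPR h0
        have h6 : (0 : ℝ) ≤ 2 ^ φ R / 2 := by positivity
        nlinarith [mul_le_mul_of_nonneg_right h5 h6]
  · have := pow_nonneg hc' j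
    gcongr
    exact hfle R

end Exposure

/-! ### Adding random non-edges to a graph -/

section AddEdges

variable {n : ℕ} {H : SimpleGraph (Fin n)}

lemma mem_nonEdges {e : Sym2 (Fin n)} : e ∈ nonEdges H ↔ e ∈ Hᶜ.edgeSet := by
  simp [nonEdges]

lemma addEdges_mono {R R' : Finset (Sym2 (Fin n))} (h : R ⊆ R') :
    addEdges H R ≤ addEdges H R' :=
  sup_le_sup_left (SimpleGraph.fromEdgeSet_mono (by exact_mod_cast h)) H

lemma mem_edgeSet_addEdges {R : Finset (Sym2 (Fin n))} (hR : R ⊆ nonEdges H) {e : Sym2 (Fin n)} :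
    e ∈ (addEdges H R).edgeSet ↔ e ∈ H.edgeSet ∨ e ∈ R := by
  rw [addEdges, SimpleGraph.edgeSet_sup, SimpleGraph.edgeSet_fromEdgeSet, Set.mem_union,
    Set.mem_sdiff, mem_coe]
  refine or_congr_right ⟨fun h => h.1, fun h => ⟨h, ?_⟩⟩
  exact Hᶜ.not_isDiag_of_mem_edgeSet (mem_nonEdges.1 (hR h))

lemma card_nonEdges_le (H : SimpleGraph (Fin n)) : (#(nonEdges H) : ℝ) ≤ n ^ 2 / 2 := by
  classical
  have h1 : #(nonEdges H) ≤ n.choose 2 := by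
    have h2 := Hᶜ.card_edgeFinset_le_card_choose_two
    rw [Fintype.card_fin] at h2
    have h3 : nonEdges H = Hᶜ.edgeFinset := by
      ext e
      simp [nonEdges]
    rwa [h3]
  have h2 : (n.choose 2 : ℝ) ≤ n ^ 2 / 2 := by
    rw [Nat.cast_choose_two]
    nlinarith [(Nat.cast_nonneg n : (0 : ℝ) ≤ n)]
  exact le_trans (by exact_mod_cast h1) h2

/-- The probability in terms of the exposure operator, for any function `f` that is the indicator
of the event. -/
lemma probAdd_eq {m : ℕ} (hm : m ≤ #(nonEdges H)) (P : SimpleGraph (Fin n) → Prop)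
    {f : Finset (Sym2 (Fin n)) → ℝ} (h1 : ∀ R, P (addEdges H R) → f R = 1)
    (h0 : ∀ R, ¬ P (addEdges H R) → f R = 0) :
    probAdd H m P = (avgStep (nonEdges H) ^ m) f ∅ := by
  classical
  have h := avgStep_pow_mul_choose (E := nonEdges H) f m ∅
  have hpos : ((#(nonEdges H)).choose m : ℝ) ≠ 0 := by
    exact_mod_cast (Nat.choose_pos hm).ne'
  have hf : ∀ R, f R = if P (addEdges H R) then 1 else 0 := fun R => by
    split_ifs with hP
    · exact h1 R hP
    · exact h0 R hP
  rw [sdiff_empty] at h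
  rw [probAdd, card_powersetCard, div_eq_iff hpos, h]
  simp only [empty_union, hf, sum_boole]

lemma probAdd_add_probAdd_not {m : ℕ} (hm : m ≤ #(nonEdges H)) (P : SimpleGraph (Fin n) → Prop) :
    probAdd H m P + probAdd H m (fun G => ¬ P G) = 1 := by
  classical
  have hpos : (#((nonEdges H).powersetCard m) : ℝ) ≠ 0 := by
    rw [card_powersetCard]
    exact_mod_cast (Nat.choose_pos hm).ne'
  rw [probAdd, probAdd, ← add_div, div_eq_one_iff_eq hpos]
  have := card_filter_add_card_filter_not (s := (nonEdges H).powersetCard m)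
    (fun R => P (addEdges H R))
  rw [← Nat.cast_add]
  congr 1
  convert this

/-- The pairs `{x, y}` with `x ∈ S` and `y ∈ W`. -/
def crossPairs {V : Type*} [DecidableEq V] (S W : Finset V) : Finset (Sym2 V) :=
  (S ×ˢ W).image fun x => s(x.1, x.2)

lemma card_crossPairs {V : Type*} [DecidableEq V] {S W : Finset V} (h : Disjoint S W) :
    #(crossPairs S W) = #S * #W := by
  rw [crossPairs, card_image_of_injOn, card_product]
  rintro ⟨a, b⟩ hab ⟨c, e⟩ hce heq
  simp only [coe_product, Set.mem_prod, mem_coe] at hab hce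
  simp only [Sym2.eq_iff] at heq
  rcases heq with ⟨rfl, rfl⟩ | ⟨rfl, rfl⟩
  · rfl
  · exact absurd hce.2 (disjoint_left.1 h hab.1)

open Classical in
/-- The pairs `(S, T)` that can witness that `H + R` does not expand: `S` and the complement of
`S ∪ T` are not joined in `H`, and `S` is too large for its expansion to follow from the minimum
degree `d * n`. -/
noncomputable def obstructions (H : SimpleGraph (Fin n)) (d : ℝ) :
    Finset (Finset (Fin n) × Finset (Fin n)) :=
  {x | d * n < 3 * #x.1 ∧ 4 * #x.1 ≤ n ∧ #x.2 = 2 * #x.1 ∧ Disjoint x.1 x.2 ∧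
    crossPairs x.1 (x.1 ∪ x.2)ᶜ ⊆ nonEdges H}

/-- The random edges only have to hit every obstruction for `H + R` to expand. -/
lemma expands_addEdges {d : ℝ} (hH : H ∈ denseGraphs n d) {R : Finset (Sym2 (Fin n))}
    (hR : R ⊆ nonEdges H)
    (h : ∀ x ∈ obstructions H d, ¬ Disjoint (crossPairs x.1 (x.1 ∪ x.2)ᶜ) R) :
    Expands (addEdges H R) := by
  classical
  intro S hS hS4
  rw [Fintype.card_fin] at hS4
  by_contra! hlt
  set G := addEdges H R with hG
  have hHG : H ≤ G := le_sup_left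
  have hsub : extNbhd G S ⊆ Sᶜ := fun u hu => mem_compl.2 (mem_extNbhd.1 hu).1
  obtain ⟨T, hT1, hT2, hT⟩ := exists_subsuperset_card_eq hsub hlt.le (by
    rw [card_compl, Fintype.card_fin]
    omega)
  have hST : Disjoint S T := disjoint_left.2 fun u hu hu' => mem_compl.1 (hT2 hu') hu
  have hnon : ∀ x ∈ S, ∀ y ∈ (S ∪ T)ᶜ, ¬ G.Adj x y := by
    intro x hx y hy hxy
    rw [mem_compl, mem_union, not_or] at hy
    exact hy.2 (hT1 (mem_extNbhd.2 ⟨hy.1, x, hx, hxy⟩))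
  have hcross : ∀ e ∈ crossPairs S (S ∪ T)ᶜ, e ∈ Gᶜ.edgeSet := by
    intro e he
    obtain ⟨⟨x, y⟩, hxy, rfl⟩ := mem_image.1 he
    rw [mem_product] at hxy
    dsimp only at hxy ⊢
    rw [SimpleGraph.mem_edgeSet, SimpleGraph.compl_adj]
    refine ⟨?_, hnon x hxy.1 y hxy.2⟩
    rintro rfl
    exact (mem_compl.1 hxy.2) (mem_union_left _ hxy.1)
  have hdeg : d * n < 3 * #S := by
    obtain ⟨v, hv⟩ := hS
    have h1 : d * n ≤ (H.minDegree : ℝ) := by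
      have := hH
      simp only [denseGraphs, Set.mem_ofPred_eq] at this
      convert this
    have h2 := H.minDegree_le_degree v
    have h3 : H.neighborFinset v ⊆ S ∪ extNbhd G S := by
      intro u hu
      rw [SimpleGraph.mem_neighborFinset] at hu
      by_cases huS : u ∈ S
      · exact mem_union_left _ huS
      · exact mem_union_right _ (mem_extNbhd.2 ⟨huS, v, hv, hHG hu⟩)
    have h4 := (card_le_card h3).trans (card_union_le _ _)
    rw [SimpleGraph.card_neighborFinset_eq_degree] at h4
    have h5 : H.minDegree < 3 * #S := by omega
    have h6 : (H.minDegree : ℝ) < 3 * #S := by exact_mod_cast h5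
    linarith
  refine h (S, T) ?_ ?_
  · simp only [obstructions, mem_filter, mem_univ, true_and]
    refine ⟨hdeg, hS4, hT, hST, fun e he => mem_nonEdges.2 ?_⟩
    exact SimpleGraph.edgeSet_mono (compl_le_compl hHG) (hcross e he)
  · refine disjoint_left.2 fun e he heR => ?_
    have h1 : e ∈ G.edgeSet := (mem_edgeSet_addEdges hR).2 (Or.inr heR)
    have h2 := hcross e he
    induction e with
    | h x y => exact (SimpleGraph.compl_adj _ _ _ |>.1 h2).2 h1

/-- From an expanding graph, `8 * n` random edges are enough to reach a Hamiltonian graph, except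
with exponentially small probability. -/
lemma avgStep_pow_hamDeficit_le (hn : 8 ≤ n) {R : Finset (Sym2 (Fin n))} (hR : R ⊆ nonEdges H)
    (hG : Expands (addEdges H R)) :
    (avgStep (nonEdges H) ^ (8 * n))
      (fun R => if hamDeficit (addEdges H R) = 0 then 0 else 1) R ≤
      Real.exp (3 - 3 / 40 * n) := by
  have : Nonempty (Fin n) := ⟨⟨0, by omega⟩⟩
  have h1 := avgStep_pow_pos_le (E := nonEdges H) (fun R => hamDeficit (addEdges H R))
    (fun R R' h => hamDeficit_anti (addEdges_mono h)) (c := 1 / 32) (by norm_num)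
    (fun R => Expands (addEdges H R)) (fun R R' h hR => hR.mono (addEdges_mono h)) ?_ (8 * n) hR hG
  · refine h1.trans ?_
    have h2 : (1 - 1 / 32 : ℝ) ^ (8 * n) ≤ Real.exp (-(n / 4)) := by
      have : (1 - 1 / 32 : ℝ) ≤ Real.exp (-(1 / 32)) := Real.one_sub_le_exp_neg _
      calc (1 - 1 / 32 : ℝ) ^ (8 * n) ≤ Real.exp (-(1 / 32)) ^ (8 * n) :=
            pow_le_pow_left₀ (by norm_num) this _
        _ = Real.exp (-(n / 4)) := by
            rw [← Real.exp_nat_mul]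
            push_cast
            ring_nf
    have h3 : (2 : ℝ) ^ hamDeficit (addEdges H R) ≤ Real.exp ((n + 13) / 4 * (7 / 10)) := by
      have h4 : 4 * (hamDeficit (addEdges H R) : ℝ) ≤ n + 13 := by
        have := hG.hamDeficit_le
        rw [Fintype.card_fin] at this
        exact_mod_cast this
      have h5 : (2 : ℝ) ≤ Real.exp (7 / 10) := by
        rw [← Real.log_le_iff_le_exp (by norm_num)]
        linarith [Real.log_two_lt_d9]
      calc (2 : ℝ) ^ hamDeficit (addEdges H R) ≤ Real.exp (7 / 10) ^ hamDeficit (addEdges H R) :=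
            pow_le_pow_left₀ (by norm_num) h5 _
        _ ≤ _ := by
            rw [← Real.exp_nat_mul]
            gcongr
            linarith
    calc _ ≤ Real.exp (-(n / 4)) * Real.exp ((n + 13) / 4 * (7 / 10)) := by gcongr
      _ ≤ _ := by
          rw [← Real.exp_add]
          gcongr
          linarith
  · intro R hR hG h0
    obtain ⟨𝓑, h𝓑, hb⟩ := hG.exists_boosters (by simpa using hn)
      (fun h => h0 (hamDeficit_eq_zero.2 h))
    have hsub : 𝓑 ⊆ {e ∈ nonEdges H \ R |
        hamDeficit (addEdges H (insert e R)) < hamDeficit (addEdges H R)} := by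
      intro e he
      obtain ⟨h2, h3⟩ := hb e he
      have heE : e ∈ nonEdges H := mem_nonEdges.2
        (SimpleGraph.edgeSet_mono (compl_le_compl (le_sup_left : H ≤ addEdges H R)) h2)
      have heR : e ∉ R := by
        intro heR
        have h4 : e ∈ (addEdges H R).edgeSet := (mem_edgeSet_addEdges hR).2 (Or.inr heR)
        induction e with
        | h x y => exact (SimpleGraph.compl_adj _ _ _ |>.1 h2).2 h4
      rw [mem_filter, mem_sdiff]
      refine ⟨⟨heE, heR⟩, h3 _ (addEdges_mono (subset_insert _ _)) ?_⟩
      rw [mem_edgeSet_addEdges (insert_subset heE hR)]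
      exact Or.inr (mem_insert_self _ _)
    refine le_trans ?_ (Nat.cast_le.2 (card_le_card hsub))
    have h5 : (#(nonEdges H \ R) : ℝ) ≤ #(nonEdges H) := by
      exact_mod_cast card_le_card sdiff_subset
    have h6 := card_nonEdges_le H
    rw [Fintype.card_fin] at h𝓑
    have h7 : (n : ℝ) ^ 2 ≤ 32 * #𝓑 := by exact_mod_cast h𝓑
    linarith

/-- A set whose proportion is at least `d / 3` has entropy at most `1 + log (3 / d)` per element,
and `1 + log 3 ≤ 12 / 5`. -/
lemma choose_le_exp {d : ℝ} (hd : 0 < d) {t : ℕ} (ht : 0 < t) (h : d * n ≤ 3 * t) :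
    (n.choose t : ℝ) ≤ Real.exp (t * (12 / 5 + Real.log (1 / d))) := by
  have ht' : (0 : ℝ) < t := by exact_mod_cast ht
  have h1 : (n : ℝ) / t ≤ 3 / d := by
    rw [div_le_div_iff₀ ht' hd]
    linarith
  have h2 : (3 : ℝ) / d ≤ Real.exp (7 / 5 + Real.log (1 / d)) := by
    rw [Real.exp_add, Real.exp_log (by positivity), div_eq_mul_one_div]
    gcongr
    have : (4 : ℝ) ≤ Real.exp (7 / 5) := by
      rw [← Real.log_le_iff_le_exp (by norm_num), show (4 : ℝ) = 2 ^ 2 by norm_num, Real.log_pow]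
      push_cast
      linarith [Real.log_two_lt_d9]
    linarith
  calc (n.choose t : ℝ) ≤ n ^ t / t.factorial := Nat.choose_le_pow_div t n
    _ = (n / t) ^ t * ((t : ℝ) ^ t / t.factorial) := by
        rw [div_pow]
        field_simp
    _ ≤ Real.exp (7 / 5 + Real.log (1 / d)) ^ t * Real.exp t := by
        gcongr
        · exact h1.trans h2
        · exact Real.pow_div_factorial_le_exp _ (by positivity) t
    _ = _ := by
        rw [← Real.exp_nat_mul, ← Real.exp_add]
        congr 1
        ring

/-- The union bound over all obstructions. -/
lemma sum_obstructions_le {d : ℝ} (hd0 : 0 < d) (hd : d ≤ 1 / 2) (hn : 0 < n) {a : ℕ}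
    (ha : (30 * Real.log (1 / d) + 5) * n ≤ a) :
    ∑ x ∈ obstructions H d,
      (1 - #(crossPairs x.1 (x.1 ∪ x.2)ᶜ) / #(nonEdges H) : ℝ) ^ a ≤
      (n + 1) * Real.exp (-(d * n)) := by
  classical
  set θ := Real.log (1 / d) with hθ
  have hθ2 : 0.69 ≤ θ := by
    have h1 : Real.log 2 ≤ θ := by
      apply Real.log_le_log (by norm_num)
      rw [le_div_iff₀ hd0]
      linarith
    linarith [Real.log_two_gt_d9]
  have hn' : (0 : ℝ) < n := by exact_mod_cast hn
  -- A random edge hits a given obstruction with probability at least `#S / (2 * n)`.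
  have hterm : ∀ x ∈ obstructions H d,
      (1 - #(crossPairs x.1 (x.1 ∪ x.2)ᶜ) / #(nonEdges H) : ℝ) ^ a ≤
      Real.exp (-((15 * θ + 5 / 2) * #x.1)) := by
    rintro ⟨S, T⟩ hx
    simp only [obstructions, mem_filter, mem_univ, true_and] at hx
    obtain ⟨h1, h2, h3, h4, h5⟩ := hx
    dsimp only
    have hS : (0 : ℝ) < #S := by
      have : 0 < d * n := by positivity
      linarith
    have hcard : #(crossPairs S (S ∪ T)ᶜ) = #S * (n - 3 * #S) := by
      rw [card_crossPairs, card_compl, card_union_of_disjoint h4, Fintype.card_fin, h3]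
      · congr 2
        ring
      · exact disjoint_left.2 fun u hu hu' => mem_compl.1 hu' (mem_union_left _ hu)
    have hcard' : (#S : ℝ) * (n / 4) ≤ #(crossPairs S (S ∪ T)ᶜ) := by
      rw [hcard, Nat.cast_mul, Nat.cast_sub (by omega)]
      have : (4 : ℝ) * #S ≤ n := by exact_mod_cast h2
      gcongr
      push_cast
      linarith
    have hle : (#(crossPairs S (S ∪ T)ᶜ) : ℝ) ≤ #(nonEdges H) := by
      exact_mod_cast card_le_card h5
    have hN : (0 : ℝ) < #(nonEdges H) := lt_of_lt_of_le (by positivity) (hcard'.trans hle)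
    have hratio : (#S : ℝ) / (2 * n) ≤ #(crossPairs S (S ∪ T)ᶜ) / #(nonEdges H) := by
      rw [div_le_div_iff₀ (by positivity) hN]
      calc (#S : ℝ) * #(nonEdges H) ≤ #S * (n ^ 2 / 2) := by
            gcongr
            exact card_nonEdges_le H
        _ = #S * (n / 4) * (2 * n) := by ring
        _ ≤ _ := by gcongr
    calc (1 - #(crossPairs S (S ∪ T)ᶜ) / #(nonEdges H) : ℝ) ^ a
        ≤ Real.exp (-(#S / (2 * n))) ^ a := by
          refine pow_le_pow_left₀ (sub_nonneg.2 (div_le_one_of_le₀ hle hN.le)) ?_ _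
          refine le_trans ?_ (Real.one_sub_le_exp_neg _)
          linarith
      _ = Real.exp (-(a * (#S / (2 * n)))) := by
          rw [← Real.exp_nat_mul]
          ring_nf
      _ ≤ _ := by
          refine Real.exp_le_exp.2 (neg_le_neg ?_)
          calc (15 * θ + 5 / 2) * #S = (30 * θ + 5) * n * (#S / (2 * n)) := by
                field_simp
                ring
            _ ≤ _ := by gcongr
  refine (sum_le_sum hterm).trans ?_
  rw [← sum_fiberwise_of_maps_to (s := obstructions H d) (t := range (n + 1)) (g := fun x => #x.1)
    (fun x _ => by
      have := card_le_univ x.1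
      rw [Fintype.card_fin] at this
      simpa [Nat.lt_succ_iff] using this)]
  -- The number of obstructions with `#S = s` is at most `exp (3 * s * (12 / 5 + θ))`; as `θ` is at
  -- least `0.69`, the exponent stays below `(15 * θ + 5 / 2) * s` by `3 * s`, and `3 * s` is larger
  -- than `d * n`.
  have hs : ∀ s ∈ range (n + 1), ∑ x ∈ obstructions H d with #x.1 = s,
      Real.exp (-((15 * θ + 5 / 2) * #x.1)) ≤ Real.exp (-(d * n)) := by
    intro s _
    rcases ({x ∈ obstructions H d | #x.1 = s} : Finset _).eq_empty_or_nonempty with he | ⟨x, hx⟩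
    · rw [he, sum_empty]
      positivity
    have hds : d * n < 3 * s := by
      simp only [obstructions, mem_filter, mem_univ, true_and] at hx
      rw [← hx.2]
      exact hx.1.1
    have hs0 : 0 < s := by
      have h1 : 0 < d * n := by positivity
      have h2 : (0 : ℝ) < s := by linarith
      exact_mod_cast h2
    have hs0' : (0 : ℝ) < s := by exact_mod_cast hs0
    have hcard : #{x ∈ obstructions H d | #x.1 = s} ≤ n.choose s * n.choose (2 * s) := by
      have hsub : ({x ∈ obstructions H d | #x.1 = s} : Finset _) ⊆
          (univ : Finset (Fin n)).powersetCard s ×ˢ univ.powersetCard (2 * s) := by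
        intro y hy
        simp only [obstructions, mem_filter, mem_univ, true_and] at hy
        simp only [mem_product, mem_powersetCard, subset_univ, true_and]
        exact ⟨hy.2, by rw [hy.1.2.2.1, hy.2]⟩
      refine (card_le_card hsub).trans ?_
      rw [card_product, card_powersetCard, card_powersetCard, card_univ, Fintype.card_fin]
    have hcard' : (#{x ∈ obstructions H d | #x.1 = s} : ℝ) ≤
        n.choose s * n.choose (2 * s) := by exact_mod_cast hcard
    calc ∑ x ∈ obstructions H d with #x.1 = s, Real.exp (-((15 * θ + 5 / 2) * #x.1))
        = #{x ∈ obstructions H d | #x.1 = s} * Real.exp (-((15 * θ + 5 / 2) * s)) := by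
          rw [← nsmul_eq_mul, ← sum_const]
          exact sum_congr rfl fun y hy => by rw [(mem_filter.1 hy).2]
      _ ≤ n.choose s * n.choose (2 * s) * Real.exp (-((15 * θ + 5 / 2) * s)) := by gcongr
      _ ≤ Real.exp (s * (12 / 5 + θ)) * Real.exp ((2 * s : ℕ) * (12 / 5 + θ)) *
            Real.exp (-((15 * θ + 5 / 2) * s)) := by
          gcongr
          · exact choose_le_exp hd0 hs0 hds.le
          · refine choose_le_exp hd0 (by omega) ?_
            push_cast
            linarith
      _ ≤ Real.exp (-(d * n)) := by
          rw [← Real.exp_add, ← Real.exp_add]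
          gcongr
          push_cast
          nlinarith
  refine (sum_le_sum hs).trans ?_
  rw [sum_const, card_range, nsmul_eq_mul]
  push_cast
  exact le_rfl

lemma probAdd_not_isHamiltonian_le {d : ℝ} (hd0 : 0 < d) (hd : d ≤ 1 / 2) (hn : 8 ≤ n)
    (hH : H ∈ denseGraphs n d) {m : ℕ} (hm : (30 * Real.log (1 / d) + 13) * n ≤ m)
    (hmE : m ≤ #(nonEdges H)) :
    probAdd H m (fun G => ¬ G.IsHamiltonian) ≤
      (n + 1) * Real.exp (-(d * n)) + Real.exp (3 - 3 / 40 * n) := by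
  classical
  have : Nonempty (Fin n) := ⟨⟨0, by omega⟩⟩
  have hθ : 0 ≤ Real.log (1 / d) := Real.log_nonneg (by rw [le_div_iff₀ hd0]; linarith)
  have h8 : 8 * n ≤ m := by
    have : (8 : ℝ) * n ≤ m := by nlinarith [(Nat.cast_nonneg n : (0 : ℝ) ≤ n)]
    exact_mod_cast this
  obtain ⟨a, rfl⟩ : ∃ a, m = a + 8 * n := ⟨m - 8 * n, by omega⟩
  push_cast at hm
  rw [probAdd_eq hmE (fun G => ¬ G.IsHamiltonian)
    (f := fun R => if hamDeficit (addEdges H R) = 0 then 0 else 1)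
    (fun R h => if_neg (mt hamDeficit_eq_zero.1 h))
    (fun R h => if_pos (hamDeficit_eq_zero.2 (not_not.1 h)))]
  refine (avgStep_pow_add_le (obstructions H d) (fun x => crossPairs x.1 (x.1 ∪ x.2)ᶜ)
    (fun x hx => ?_) (fun R => ?_) (Real.exp_pos (3 - 3 / 40 * n)).le a (8 * n)
    fun R hR h => avgStep_pow_hamDeficit_le hn hR (expands_addEdges hH hR h)).trans ?_
  · simp only [obstructions, mem_filter, mem_univ, true_and] at hx
    exact hx.2.2.2.2
  · split_ifs <;> norm_num
  · gcongr
    exact sum_obstructions_le hd0 hd (by omega) (by linarith)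

lemma tendsto_failure_bound {d : ℝ} (hd : 0 < d) :
    Filter.Tendsto (fun n : ℕ => (n + 1) * Real.exp (-(d * n)) + Real.exp (3 - 3 / 40 * n))
      Filter.atTop (nhds 0) := by
  have hdn : Filter.Tendsto (fun n : ℕ => d * n) Filter.atTop Filter.atTop :=
    tendsto_natCast_atTop_atTop.const_mul_atTop hd
  have h0 := (Real.tendsto_pow_mul_exp_neg_atTop_nhds_zero 0).comp hdn
  have h1 := ((Real.tendsto_pow_mul_exp_neg_atTop_nhds_zero 1).comp hdn).const_mul (1 / d)
  have hdn' : Filter.Tendsto (fun n : ℕ => 3 / 40 * (n : ℝ)) Filter.atTop Filter.atTop :=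
    tendsto_natCast_atTop_atTop.const_mul_atTop (by norm_num)
  have h2 := ((Real.tendsto_pow_mul_exp_neg_atTop_nhds_zero 0).comp hdn').const_mul (Real.exp 3)
  have h3 := (h1.add h0).add h2
  simp only [mul_zero, add_zero] at h3
  refine h3.congr fun n => ?_
  simp only [Function.comp, pow_zero, pow_one, one_mul, sub_eq_add_neg, Real.exp_add]
  field_simp

end AddEdges

/-! ### The second moment of the number of missed sets -/

section SecondMoment

variable {α : Type*} [DecidableEq α] {E : Finset α}

lemma missInd_union (F F' R : Finset α) : missInd (F ∪ F') R = missInd F R * missInd F' R := by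
  by_cases h : Disjoint F R <;> by_cases h' : Disjoint F' R <;> simp [missInd, h, h']

/-- The exact probability that `j` further random elements miss `F`. -/
lemma avgStep_pow_missInd {F : Finset α} (hF : F ⊆ E) (j : ℕ) {R : Finset α} (hR : R ⊆ E)
    (hj : #R + j ≤ #E) :
    (avgStep E ^ j) (missInd F) R =
      (∏ i ∈ range j, (1 - #F / (#E - #R - i) : ℝ)) * missInd F R := by
  induction j generalizing R with
  | zero => simp
  | succ j ih =>
    have hX : (#(E \ R) : ℝ) = #E - #R := by
      rw [card_sdiff_of_subset hR, Nat.cast_sub (card_le_card hR)]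
    have hX0 : (#E - #R : ℝ) ≠ 0 := by
      have : (#R : ℝ) + (j + 1) ≤ #E := by exact_mod_cast hj
      have : (0 : ℝ) ≤ j := by positivity
      intro h
      linarith
    have h1 : ∀ e ∈ E \ R, (avgStep E ^ j) (missInd F) (insert e R) =
        (∏ i ∈ range j, (1 - #F / (#E - #R - (i + 1 : ℕ)) : ℝ)) * missInd F (insert e R) := by
      intro e he
      have hcard : #(insert e R) = #R + 1 := card_insert_of_notMem (mem_sdiff.1 he).2
      rw [ih (insert_subset_of_mem_sdiff hR he) (by omega), hcard]
      congr 1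
      refine prod_congr rfl fun i _ => ?_
      push_cast
      ring
    have h2 : ∑ e ∈ E \ R, missInd F (insert e R) = (#E - #R - #F) * missInd F R := by
      by_cases hd : Disjoint F R
      · have hFX : F ⊆ E \ R := fun x hx => mem_sdiff.2 ⟨hF hx, disjoint_left.1 hd hx⟩
        have h3 : ∀ e, missInd F (insert e R) = if e ∉ F then 1 else 0 := by
          intro e
          simp [missInd, disjoint_insert_right, hd]
        rw [sum_congr rfl fun e _ => h3 e, ← sum_filter, sum_const, nsmul_eq_mul, mul_one,
          ← sdiff_eq_filter, card_sdiff_of_subset hFX, Nat.cast_sub (card_le_card hFX), hX]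
        simp [missInd, hd]
      · rw [sum_eq_zero fun e _ => by simp [missInd, disjoint_insert_right, hd]]
        simp [missInd, hd]
    rw [pow_succ', Module.End.mul_apply, avgStep_apply, sum_congr rfl h1, ← mul_sum, h2, hX,
      prod_range_succ']
    simp only [Nat.cast_zero, sub_zero]
    field_simp

/-- **Chebyshev's inequality** for the number of sets `F i` that a random `m`-element set misses,
where each is missed with probability `p`, and any two with probability at most `q`. -/
lemma avgStep_pow_few_missed_le {ι : Type*} (I : Finset ι) (F : ι → Finset α) (m : ℕ) {p q a : ℝ}
    (hp : ∀ i ∈ I, (avgStep E ^ m) (missInd (F i)) ∅ = p)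
    (hp1 : p ≤ 1) (hq0 : 0 ≤ q)
    (hq : ∀ i ∈ I, ∀ j ∈ I, i ≠ j → (avgStep E ^ m) (missInd (F i ∪ F j)) ∅ ≤ q)
    (ha : a < #I * p) {f : Finset α → ℝ} (hf1 : ∀ R, f R ≤ 1)
    (hf0 : ∀ R, a < ∑ i ∈ I, missInd (F i) R → f R ≤ 0) :
    (avgStep E ^ m) f ∅ ≤ (#I + #I ^ 2 * (q - p ^ 2)) / (#I * p - a) ^ 2 := by
  classical
  set μ : ℝ := #I * p with hμ
  have hpos : 0 < (μ - a) ^ 2 := by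
    have : 0 < μ - a := by linarith
    positivity
  let g : Finset α → ℝ := (∑ i ∈ I, ∑ j ∈ I, missInd (F i ∪ F j)) -
    (2 * μ) • (∑ i ∈ I, missInd (F i)) + fun _ => μ ^ 2
  have hg : ∀ R, g R = (∑ i ∈ I, missInd (F i) R - μ) ^ 2 := by
    intro R
    have h1 : ∑ i ∈ I, ∑ j ∈ I, missInd (F i ∪ F j) R = (∑ i ∈ I, missInd (F i) R) ^ 2 := by
      rw [sq, sum_mul_sum]
      exact sum_congr rfl fun i _ => sum_congr rfl fun j _ => missInd_union _ _ _
    simp only [g, Pi.add_apply, Pi.sub_apply, Pi.smul_apply, Finset.sum_apply, smul_eq_mul, h1]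
    ring
  have hfg : ∀ R ⊆ E, ((μ - a) ^ 2 • f) R ≤ g R := by
    intro R _
    rw [hg, Pi.smul_apply, smul_eq_mul]
    by_cases hX : a < ∑ i ∈ I, missInd (F i) R
    · exact (mul_nonpos_of_nonneg_of_nonpos hpos.le (hf0 R hX)).trans (sq_nonneg _)
    · push Not at hX
      calc (μ - a) ^ 2 * f R ≤ (μ - a) ^ 2 * 1 := by
            gcongr
            exact hf1 R
        _ ≤ _ := by nlinarith
  have h1 := avgStep_pow_mono hfg m ∅ (empty_subset _)
  rw [map_smul, Pi.smul_apply, smul_eq_mul] at h1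
  have hrow : ∀ i ∈ I, ∑ j ∈ I, (avgStep E ^ m) (missInd (F i ∪ F j)) ∅ ≤ p + #I * q := by
    intro i hi
    rw [← add_sum_erase I _ hi, union_self, hp i hi]
    gcongr
    calc ∑ j ∈ I.erase i, (avgStep E ^ m) (missInd (F i ∪ F j)) ∅ ≤ ∑ _j ∈ I.erase i, q :=
          sum_le_sum fun j hj =>
            hq i hi j (mem_of_mem_erase hj) (ne_of_mem_erase hj).symm
      _ ≤ #I * q := by
          rw [sum_const, nsmul_eq_mul]
          gcongr
          exact erase_subset _ _
  have h2 : (avgStep E ^ m) g ∅ ≤ #I * (p + #I * q) - 2 * μ * μ + μ ^ 2 := by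
    simp only [g, map_add, map_sub, map_smul, map_sum, Pi.add_apply, Pi.sub_apply, Pi.smul_apply,
      Finset.sum_apply, smul_eq_mul]
    rw [sum_congr rfl hp, sum_const, nsmul_eq_mul, ← hμ]
    gcongr
    · refine (sum_le_sum hrow).trans ?_
      rw [sum_const, nsmul_eq_mul]
    · exact avgStep_pow_const_le (sq_nonneg _) m (empty_subset _)
  rw [le_div_iff₀ hpos, mul_comm]
  refine (h1.trans h2).trans ?_
  have h3 : (#I : ℝ) * p ≤ #I := mul_le_of_le_one_right (by positivity) hp1
  rw [hμ]
  nlinarith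

end SecondMoment

/-! ### The probability of missing a given set -/

section MissProduct

variable {k N m : ℕ}

lemma exp_le_prod_one_sub (h : 2 * k + m < N) :
    Real.exp (-(m * (k / (N - m - k)))) ≤ ∏ i ∈ range m, (1 - k / (N - i) : ℝ) := by
  have h' : (2 * k + m : ℝ) < N := by exact_mod_cast h
  have hk : (0 : ℝ) ≤ k := by positivity
  have hD : (0 : ℝ) < N - m - k := by linarith
  have hNm : (0 : ℝ) < N - m := by linarith
  have h1 : Real.exp (-(k / (N - m - k))) ≤ 1 - k / (N - m : ℝ) := by
    rw [Real.exp_neg, inv_le_comm₀ (Real.exp_pos _)]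
    · have h2 := Real.add_one_le_exp (k / (N - m - k) : ℝ)
      refine le_trans (le_of_eq ?_) h2
      have : (1 - k / (N - m) : ℝ) = (N - m - k) / (N - m) := by
        field_simp
      rw [this]
      field_simp
      ring
    · rw [sub_pos, div_lt_one hNm]
      linarith
  calc Real.exp (-(m * (k / (N - m - k)))) = ∏ _i ∈ range m, Real.exp (-(k / (N - m - k))) := by
        rw [prod_const, card_range, ← Real.exp_nat_mul]
        ring_nf
    _ ≤ _ := by
        refine prod_le_prod (fun _ _ => (Real.exp_pos _).le) fun i hi => h1.trans ?_
        have : (i : ℝ) ≤ m := by exact_mod_cast (mem_range.1 hi).le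
        gcongr

lemma prod_one_sub_mem (h : k + m < N) :
    (∏ i ∈ range m, (1 - k / (N - i) : ℝ)) ∈ Set.Icc (0 : ℝ) 1 := by
  have h' : (k + m : ℝ) < N := by exact_mod_cast h
  have hk : (0 : ℝ) ≤ k := by positivity
  have hi : ∀ i ∈ range m, 0 ≤ (1 - k / (N - i) : ℝ) ∧ (1 - k / (N - i) : ℝ) ≤ 1 := by
    intro i hi
    have : (i : ℝ) ≤ m := by exact_mod_cast (mem_range.1 hi).le
    have hpos : (0 : ℝ) < N - i := by linarith
    refine ⟨?_, ?_⟩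
    · rw [sub_nonneg, div_le_one hpos]
      linarith
    · have : (0 : ℝ) ≤ k / (N - i) := by positivity
      linarith
  exact ⟨prod_nonneg fun i h => (hi i h).1,
    prod_le_one (fun i h => (hi i h).1) fun i h => (hi i h).2⟩

/-- Missing two sets of size `k` with one common element is almost uncorrelated. -/
lemma prod_one_sub_le (hk1 : 1 ≤ k) (h : 2 * k + m < N) (hm : 5 * m ≤ N) :
    (∏ i ∈ range m, (1 - (2 * k - 1 : ℕ) / (N - i) : ℝ)) ≤
      (∏ i ∈ range m, (1 - k / (N - i) : ℝ)) ^ 2 + 8 * m / (N - m) := by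
  have h' : (2 * k + m : ℝ) < N := by exact_mod_cast h
  have hm' : (5 * m : ℝ) ≤ N := by exact_mod_cast hm
  have hk : (0 : ℝ) ≤ k := by positivity
  have hNm : (0 : ℝ) < N - m := by linarith
  obtain ⟨h0, h1⟩ := prod_one_sub_mem (k := k) (N := N) (m := m) (by omega)
  set P := ∏ i ∈ range m, (1 - k / (N - i) : ℝ) with hP
  have hz : (0 : ℝ) ≤ m * (4 / (N - m)) := by positivity
  have hz1 : (m * (4 / (N - m)) : ℝ) ≤ 1 := by
    rw [← mul_div_assoc, div_le_one hNm]
    linarith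
  calc (∏ i ∈ range m, (1 - (2 * k - 1 : ℕ) / (N - i) : ℝ))
      ≤ ∏ i ∈ range m, ((1 - k / (N - i) : ℝ) ^ 2 * Real.exp (4 / (N - m))) := by
        refine prod_le_prod (fun i hi => ?_) (fun i hi => ?_)
        · have : (i : ℝ) ≤ m := by exact_mod_cast (mem_range.1 hi).le
          rw [sub_nonneg, div_le_one (by linarith), Nat.cast_sub (by omega)]
          push_cast
          linarith
        · have him : (i : ℝ) ≤ m := by exact_mod_cast (mem_range.1 hi).le
          have hpos : (0 : ℝ) < N - i := by linarith
          rw [Nat.cast_sub (by omega)]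
          push_cast
          set y : ℝ := 1 / (N - i) with hy
          have hy0 : 0 < y := by positivity
          have hyk : (k : ℝ) / (N - i) = k * y := by rw [hy]; ring
          have hyk' : (2 * k - 1 : ℝ) / (N - i) = (2 * k - 1) * y := by rw [hy]; ring
          have hx : k * y ≤ 1 / 2 := by
            rw [← hyk, div_le_iff₀ hpos]
            linarith
          have hy4 : 4 * y ≤ 4 / (N - m) := by
            rw [hy, ← mul_div_assoc, mul_one]
            gcongr
          have hexp : 1 + 4 * y ≤ Real.exp (4 / (N - m)) := by
            linarith [Real.add_one_le_exp (4 / (N - m) : ℝ)]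
          rw [hyk, hyk']
          calc 1 - (2 * k - 1) * y ≤ (1 - k * y) ^ 2 * (1 + 4 * y) := by
                have h4 : 1 / 4 ≤ (1 - k * y) ^ 2 := by nlinarith
                nlinarith [sq_nonneg (k * y)]
            _ ≤ _ := by gcongr
    _ = P ^ 2 * Real.exp (m * (4 / (N - m))) := by
        rw [prod_mul_distrib, prod_pow, prod_const, card_range, ← Real.exp_nat_mul]
    _ ≤ P ^ 2 * (1 + 2 * (m * (4 / (N - m)))) := by
        gcongr
        have := Real.abs_exp_sub_one_le (x := m * (4 / (N - m))) (by rwa [abs_of_nonneg hz])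
        rw [abs_of_nonneg hz] at this
        linarith [le_abs_self (Real.exp (m * (4 / (N - m))) - 1)]
    _ = P ^ 2 + P ^ 2 * (8 * m / (N - m)) := by ring
    _ ≤ _ := by
        gcongr
        refine mul_le_of_le_one_left (by positivity) ?_
        exact pow_le_one₀ h0 h1

end MissProduct

/-! ### Unbalanced complete bipartite graphs -/

/-- The complete bipartite graph with parts `A` and `Aᶜ`. -/
def bipartiteGraph {V : Type*} (A : Finset V) : SimpleGraph V where
  Adj u v := u ∈ A ↔ v ∉ A
  symm := ⟨fun u v h => by tauto⟩
  loopless := ⟨fun u h => by tauto⟩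

/-- All pairs that consist of `v` and another vertex of `B`. -/
def pairsAt {V : Type*} [DecidableEq V] (B : Finset V) (v : V) : Finset (Sym2 V) :=
  (B.erase v).image fun u => s(v, u)

section PairsAt

variable {V : Type*} [DecidableEq V] {B : Finset V} {u v : V}

lemma card_pairsAt (hv : v ∈ B) : #(pairsAt B v) = #B - 1 := by
  rw [pairsAt, card_image_of_injective, card_erase_of_mem hv]
  exact fun x y hxy => Sym2.congr_right.1 hxy

lemma card_pairsAt_union (hu : u ∈ B) (hv : v ∈ B) (huv : u ≠ v) :
    #(pairsAt B u ∪ pairsAt B v) = 2 * (#B - 1) - 1 := by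
  have h1 : pairsAt B u ∩ pairsAt B v = {s(u, v)} := by
    ext e
    simp only [pairsAt, mem_inter, mem_image, mem_erase, mem_singleton]
    constructor
    · rintro ⟨⟨x, hx, rfl⟩, y, hy, h⟩
      simp only [Sym2.eq_iff] at h
      rcases h with ⟨rfl, rfl⟩ | ⟨rfl, rfl⟩
      · exact absurd rfl huv
      · rfl
    · rintro rfl
      exact ⟨⟨v, ⟨huv.symm, hv⟩, rfl⟩, u, ⟨huv, hu⟩, Sym2.eq_swap⟩
  have h2 := card_union_add_card_inter (pairsAt B u) (pairsAt B v)
  rw [h1, card_singleton, card_pairsAt hu, card_pairsAt hv] at h2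
  omega

end PairsAt

section Bipartite

variable {n : ℕ} {A : Finset (Fin n)}

lemma bipartiteGraph_mem_denseGraphs {d : ℝ} (hn : 0 < n) (hA : d * n ≤ #A) (hA' : #A ≤ #Aᶜ) :
    bipartiteGraph A ∈ denseGraphs n d := by
  classical
  have : Nonempty (Fin n) := ⟨⟨0, hn⟩⟩
  simp only [denseGraphs, Set.mem_ofPred_eq]
  refine hA.trans ?_
  norm_cast
  refine SimpleGraph.le_minDegree_of_forall_le_degree _ _ fun v => ?_
  rw [← SimpleGraph.card_neighborFinset_eq_degree]
  by_cases hv : v ∈ A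
  · refine hA'.trans (card_le_card fun u hu => ?_)
    rw [SimpleGraph.mem_neighborFinset]
    simpa [bipartiteGraph, hv] using hu
  · refine card_le_card fun u hu => ?_
    rw [SimpleGraph.mem_neighborFinset]
    simpa [bipartiteGraph, hv] using hu

lemma choose_two_le_card_nonEdges : (#Aᶜ).choose 2 ≤ #(nonEdges (bipartiteGraph A)) := by
  rw [← Sym2.card_image_offDiag]
  refine card_le_card fun e he => ?_
  obtain ⟨⟨x, y⟩, hxy, rfl⟩ := mem_image.1 he
  rw [mem_offDiag, mem_compl, mem_compl] at hxy
  refine mem_nonEdges.2 ((SimpleGraph.compl_adj _ _ _).2 ⟨hxy.2.2, fun h => ?_⟩)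
  exact hxy.1 (h.2 hxy.2.1)

lemma pairsAt_subset_nonEdges {v : Fin n} (hv : v ∈ Aᶜ) :
    pairsAt Aᶜ v ⊆ nonEdges (bipartiteGraph A) := by
  intro e he
  obtain ⟨x, hx, rfl⟩ := mem_image.1 he
  rw [mem_erase, mem_compl] at hx
  rw [mem_compl] at hv
  refine mem_nonEdges.2 ((SimpleGraph.compl_adj _ _ _).2 ⟨hx.1.symm, fun h => ?_⟩)
  exact hv (h.2 hx.2)

/-- If more than `#A` vertices outside `A` have no added edge inside `Aᶜ`, there is no Hamiltonian
cycle. -/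
lemma not_isHamiltonian_addEdges (hn : n ≠ 1) {R : Finset (Sym2 (Fin n))}
    (hR : (#A : ℝ) < ∑ v ∈ Aᶜ, missInd (pairsAt Aᶜ v) R) :
    ¬ (addEdges (bipartiteGraph A) R).IsHamiltonian := by
  classical
  intro hH
  have hsum : ∑ v ∈ Aᶜ, missInd (pairsAt Aᶜ v) R = #{v ∈ Aᶜ | Disjoint (pairsAt Aᶜ v) R} := by
    rw [card_filter]
    push_cast
    exact sum_congr rfl fun v _ => by simp [missInd]
  rw [hsum] at hR
  norm_cast at hR
  refine absurd (hH.card_le_of_forall_adj (by simpa using hn) (A := A) ?_) (not_le.2 hR)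
  intro u hu v huv
  rw [mem_filter, mem_compl] at hu
  by_contra hv
  rw [addEdges, SimpleGraph.sup_adj, SimpleGraph.fromEdgeSet_adj, mem_coe] at huv
  rcases huv with huv | huv
  · exact hu.1 (huv.2 hv)
  · refine disjoint_left.1 hu.2 (mem_image.2 ⟨v, ?_, rfl⟩) huv.1
    rw [mem_erase, mem_compl]
    exact ⟨huv.2.symm, hv⟩

lemma probAdd_bipartiteGraph_le {d : ℝ} (hd0 : 0 < d) (hd : d ≤ 1 / 10)
    (hA : #A = ⌈d * n⌉₊) (hn1 : 100 * (Real.log (1 / d) + 1) ≤ n) (hn2 : 30 ≤ d * n) {m : ℕ}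
    (hm : (m : ℝ) < Real.log (1 / d) * n / 3) :
    m ≤ #(nonEdges (bipartiteGraph A)) ∧
    probAdd (bipartiteGraph A) m (fun G => G.IsHamiltonian) ≤
      100 * (1 + 11 * Real.log (1 / d)) / d ^ 2 / n := by
  classical
  set θ := Real.log (1 / d) with hθ
  have hθ2 : 2 ≤ θ := by
    have h1 : Real.log 8 ≤ θ := by
      apply Real.log_le_log (by norm_num)
      rw [le_div_iff₀ hd0]
      linarith
    rw [show (8 : ℝ) = 2 ^ 3 by norm_num, Real.log_pow] at h1
    push_cast at h1
    linarith [Real.log_two_gt_d9]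
  have hn : (300 : ℝ) ≤ n := by linarith
  set N := #(nonEdges (bipartiteGraph A)) with hN
  set b := #Aᶜ with hb
  have hab : #A + b = n := by
    have := card_add_card_compl A
    rwa [Fintype.card_fin] at this
  have habR : (#A : ℝ) + b = n := by exact_mod_cast hab
  have hA1 : d * n ≤ #A := hA ▸ Nat.le_ceil _
  have hA2 : (#A : ℝ) < d * n + 1 := hA ▸ Nat.ceil_lt_add_one (by positivity)
  have hdn : d * n ≤ n / 10 := by nlinarith
  have hb1 : 9 / 10 * (n : ℝ) - 1 ≤ b := by linarith
  have hb2 : (b : ℝ) ≤ n := by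
    have : (0 : ℝ) ≤ #A := by positivity
    linarith
  have hb3 : 2 ≤ b := by
    have : (2 : ℝ) ≤ b := by linarith
    exact_mod_cast this
  obtain ⟨k, hk⟩ : ∃ k, b = k + 1 := ⟨b - 1, by omega⟩
  have hbk : (b : ℝ) = k + 1 := by exact_mod_cast hk
  have hNb : (b : ℝ) * k / 2 ≤ N := by
    have h1 : (b.choose 2 : ℝ) ≤ N := by exact_mod_cast choose_two_le_card_nonEdges (A := A)
    rw [Nat.cast_choose_two] at h1
    rwa [show (b : ℝ) - 1 = k by linarith] at h1
  have hk1 : 9 / 10 * (n : ℝ) - 2 ≤ k := by linarith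
  have hkn' : (k : ℝ) ≤ n := by linarith
  have hmk : (m : ℝ) + k ≤ n ^ 2 / 100 := by
    have h1 : 100 * (θ + 1) * n ≤ (n : ℝ) * n := by gcongr
    have h2 : 0 ≤ θ * n := by positivity
    linarith
  have hD : (n : ℝ) ^ 2 / 4 ≤ N - m - k := by
    have h1 : (9 / 10 * (n : ℝ) - 1) * (9 / 10 * n - 2) ≤ b * k := by
      gcongr
      linarith
    have h2 : 300 * (n : ℝ) ≤ n * n := by gcongr
    linarith
  have hkn : (k : ℝ) * n ≤ 12 / 5 * (N - m - k) := by
    have h1 : (9 / 10 * (n : ℝ) - 2) * (8 / 100 * n - 6 / 5) ≤ k * (6 / 5 * b - n) :=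
      mul_le_mul hk1 (by linarith) (by linarith) (Nat.cast_nonneg k)
    have h2 : 300 * (n : ℝ) ≤ n * n := by gcongr
    linarith
  have hnn : 300 * (n : ℝ) ≤ n ^ 2 := by
    rw [sq]
    gcongr
  have hk0 : (0 : ℝ) ≤ k := by positivity
  have hDpos : (0 : ℝ) < N - m - k := lt_of_lt_of_le (by positivity) hD
  have hkm : 2 * k + m < N := by
    have : (2 * k + m : ℝ) < N := by linarith
    exact_mod_cast this
  have h5m : 5 * m ≤ N := by
    have : (5 * m : ℝ) ≤ N := by linarith
    exact_mod_cast this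
  set p := ∏ i ∈ range m, (1 - k / (N - i) : ℝ) with hp
  set q := ∏ i ∈ range m, (1 - (2 * k - 1 : ℕ) / (N - i) : ℝ) with hq
  have hp1 := (prod_one_sub_mem (k := k) (N := N) (m := m) (by omega)).2
  have hq0 := (prod_one_sub_mem (k := 2 * k - 1) (N := N) (m := m) (by omega)).1
  have hqp := prod_one_sub_le (k := k) (N := N) (m := m) (by omega) hkm h5m
  have hple := exp_le_prod_one_sub hkm
  rw [← hp] at hp1 hqp hple
  rw [← hq] at hq0 hqp
  have hmiss : ∀ F ⊆ nonEdges (bipartiteGraph A), (avgStep (nonEdges (bipartiteGraph A)) ^ m)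
      (missInd F) ∅ = ∏ i ∈ range m, (1 - #F / (N - i) : ℝ) := by
    intro F hF
    rw [avgStep_pow_missInd hF m (empty_subset _) (by rw [card_empty]; omega)]
    simp [missInd, hN]
  -- The probability `p` that a vertex outside `A` receives no edge is at least
  -- `d ^ (4 / 5) = d * exp (θ / 5)`.
  have hpd : 7 / 5 * d ≤ p := by
    have h1 : (m * (k / (N - m - k)) : ℝ) ≤ 4 / 5 * θ := by
      rw [← mul_div_assoc, div_le_iff₀ hDpos]
      calc (m : ℝ) * k ≤ θ * n / 3 * k := by gcongr
        _ = θ / 3 * (k * n) := by ring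
        _ ≤ θ / 3 * (12 / 5 * (N - m - k)) := by gcongr
        _ = 4 / 5 * θ * (N - m - k) := by ring
    have h2 : d * Real.exp (θ / 5) ≤ p := by
      refine le_trans (le_of_eq ?_) ((Real.exp_le_exp.2 (neg_le_neg h1)).trans hple)
      have h3 : d = Real.exp (-θ) := by
        rw [hθ, one_div, Real.log_inv, neg_neg, Real.exp_log hd0]
      conv_lhs => rw [h3]
      rw [← Real.exp_add]
      congr 1
      ring
    have h4 : 7 / 5 ≤ Real.exp (θ / 5) := by linarith [Real.add_one_le_exp (θ / 5)]
    have h5 : d * (7 / 5) ≤ d * Real.exp (θ / 5) := by gcongr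
    linarith
  have hmean : d * n / 10 ≤ b * p - #A := by
    have h1 : (b : ℝ) * (7 / 5 * d) ≤ b * p := by gcongr
    have h2 : (9 / 10 * (n : ℝ) - 1) * (7 / 5 * d) ≤ b * (7 / 5 * d) := by gcongr
    linarith
  have hdn0 : 0 < d * n / 10 := by linarith
  refine ⟨by omega, ?_⟩
  rw [probAdd_eq (by omega) (fun G => G.IsHamiltonian)
    (f := fun R => if (addEdges (bipartiteGraph A) R).IsHamiltonian then 1 else 0)
    (fun R h => if_pos h) (fun R h => if_neg h)]
  have hnne : n ≠ 1 := by
    rintro rfl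
    norm_num at hn
  have hcheb := avgStep_pow_few_missed_le (E := nonEdges (bipartiteGraph A)) Aᶜ (pairsAt Aᶜ) m
    (p := p) (q := q) (a := #A)
    (f := fun R => if (addEdges (bipartiteGraph A) R).IsHamiltonian then 1 else 0)
    (fun v hv => by
      rw [hmiss _ (pairsAt_subset_nonEdges hv), card_pairsAt hv, ← hb, hk, Nat.add_sub_cancel])
    hp1 hq0
    (fun u hu v hv huv => by
      rw [hmiss _ (union_subset (pairsAt_subset_nonEdges hu) (pairsAt_subset_nonEdges hv)),
        card_pairsAt_union hu hv huv, ← hb, hk, Nat.add_sub_cancel])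
    (by rw [← hb]; linarith)
    (fun R => by split_ifs <;> norm_num)
    (fun R hR => by rw [if_neg (not_isHamiltonian_addEdges hnne hR)])
  refine hcheb.trans ?_
  rw [← hb]
  have hqp' : q - p ^ 2 ≤ 32 / 3 * θ / n := by
    have h1 : (8 * m : ℝ) / (N - m) ≤ 32 / 3 * θ / n := by
      rw [div_le_div_iff₀ (by linarith) (by linarith)]
      calc 8 * (m : ℝ) * n ≤ 8 * (θ * n / 3) * n := by gcongr
        _ = 32 / 3 * θ * (n ^ 2 / 4) := by ring
        _ ≤ _ := by
            gcongr
            linarith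
    linarith
  calc (b + b ^ 2 * (q - p ^ 2)) / (b * p - #A) ^ 2
      ≤ (n + n ^ 2 * (32 / 3 * θ / n)) / (d * n / 10) ^ 2 := by
        have h1 : (b : ℝ) ^ 2 * (q - p ^ 2) ≤ b ^ 2 * (32 / 3 * θ / n) := by gcongr
        have h2 : (b : ℝ) ^ 2 * (32 / 3 * θ / n) ≤ n ^ 2 * (32 / 3 * θ / n) := by gcongr
        exact div_le_div₀ (by positivity) (by linarith) (by positivity)
          (pow_le_pow_left₀ hdn0.le hmean 2)
    _ = 100 * (1 + 32 / 3 * θ) / d ^ 2 / n := by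
        have : (n : ℝ) ≠ 0 := by linarith
        field_simp
        ring
    _ ≤ _ := by
        gcongr
        norm_num

end Bipartite

theorem theorem1 (d : ℝ) (hd0 : 0 < d) (hd : d ≤ 1 / 2) :
    (∀ ε : ℝ, 0 < ε → ∃ n₀ : ℕ, ∀ n : ℕ, n₀ ≤ n → ∀ H ∈ denseGraphs n d, ∀ m : ℕ,
      (30 * Real.log (1 / d) + 13) * n ≤ m → m ≤ #(nonEdges H) →
        1 - ε ≤ probAdd H m (fun G => G.IsHamiltonian)) ∧
    (d ≤ 1 / 10 → ∃ H : (n : ℕ) → SimpleGraph (Fin n),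
      (∀ n : ℕ, 3 ≤ n → H n ∈ denseGraphs n d ∧ IsUnbalancedCompleteBipartite (H n)) ∧
      ∀ ε : ℝ, 0 < ε → ∃ n₀ : ℕ, ∀ n : ℕ, n₀ ≤ n → ∀ m : ℕ,
        (m : ℝ) < Real.log (1 / d) * n / 3 →
          1 - ε ≤ probAdd (H n) m (fun G => ¬ G.IsHamiltonian)) := by
  refine ⟨fun ε hε => ?_, fun hd' => ?_⟩
  · obtain ⟨n₀, hn₀⟩ := Filter.eventually_atTop.1
      ((tendsto_failure_bound hd0).eventually_le_const hε)
    refine ⟨max n₀ 8, fun n hn H hH m hm hmE => ?_⟩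
    have h1 := probAdd_add_probAdd_not hmE (fun G => G.IsHamiltonian)
    have h2 := probAdd_not_isHamiltonian_le hd0 hd (le_of_max_le_right hn) hH hm hmE
    linarith [hn₀ n (le_of_max_le_left hn)]
  · have hceil : ∀ n : ℕ, ⌈d * n⌉₊ ≤ n := fun n => Nat.ceil_le.2 (by
      have : (0 : ℝ) ≤ n := by positivity
      nlinarith)
    have hA : ∀ n : ℕ, ∃ A : Finset (Fin n), #A = ⌈d * n⌉₊ := fun n => by
      obtain ⟨A, -, hA⟩ := exists_subset_card_eq (s := (univ : Finset (Fin n))) (n := ⌈d * n⌉₊)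
        (by simpa using hceil n)
      exact ⟨A, hA⟩
    choose A hA using hA
    refine ⟨fun n => bipartiteGraph (A n), fun n hn => ?_, fun ε hε => ?_⟩
    · have hn0 : (0 : ℝ) < n := by
        have : 0 < n := by omega
        exact_mod_cast this
      have hlt : #(A n) < #(A n)ᶜ := by
        rw [card_compl, Fintype.card_fin, hA]
        -- For `n ≤ 10` the smaller part has one vertex, otherwise at most `n / 10 + 1`.
        have h1 : ⌈d * n⌉₊ ≤ (n + 9) / 10 := by
          refine Nat.ceil_le.2 ?_
          have h2 : n ≤ 10 * ((n + 9) / 10) := by omega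
          have h3 : (n : ℝ) ≤ 10 * ((n + 9) / 10 : ℕ) := by exact_mod_cast h2
          nlinarith
        omega
      refine ⟨bipartiteGraph_mem_denseGraphs (by omega) (hA n ▸ Nat.le_ceil _) hlt.le,
        A n, ?_, hlt, fun u v => Iff.rfl⟩
      rw [← card_pos, hA, Nat.ceil_pos]
      positivity
    · set C := 100 * (1 + 11 * Real.log (1 / d)) / d ^ 2
      have hlim := tendsto_natCast_atTop_atTop (R := ℝ)
      have hC : Filter.Tendsto (fun n : ℕ => C / n) Filter.atTop (nhds 0) :=
        tendsto_const_nhds.div_atTop hlim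
      obtain ⟨n₀, hn₀⟩ := Filter.eventually_atTop.1 ((hC.eventually_le_const hε).and
        ((hlim.eventually_ge_atTop (100 * (Real.log (1 / d) + 1))).and
          (hlim.eventually_ge_atTop (30 / d))))
      refine ⟨n₀, fun n hn m hm => ?_⟩
      obtain ⟨h1, h2, h3⟩ := hn₀ n hn
      rw [div_le_iff₀' hd0] at h3
      obtain ⟨h4, h5⟩ := probAdd_bipartiteGraph_le hd0 hd' (hA n) h2 h3 hm
      have h6 := probAdd_add_probAdd_not h4 (fun G => G.IsHamiltonian)
      linarith
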